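/- Let $k$ be a field, $V$ a finite dimensional $k$-vector space, $T(V)$ its tensor algebra, and write $V^{(n)} = V^{\otimes n}$. Let $S \subseteq \mathbb{N}_{\geq 2}$ be a finite set and, for each $s \in S$, let $R_s \subseteq V^{(s)}$ be a subspace, such that the minimality condition $$R_s \cap \sum_{t \in S,\, t < s}\ \sum_{j=0}^{s-t} V^{(j)} \otimes R_t \otimes V^{(s-t-j)} = 0 \qquad (s \in S)$$ holds. Put $R = \bigoplus_{s \in S} R_s$, $A = T(V)/\langle R \rangle$ and $A^s = T(V)/\langle R_s\rangle$ for $s \in S$. For $s\in S$ let $n_s(2l) = sl$ and $n_s(2l+1) = sl+1$. Put $J_0 = k$, $J_1 = V$ and, for $i \geq 2$, $J_i = \bigoplus_{s \in S} J_i^s$ with $J_i^s = \bigcap_{j=0}^{n_s(i)-s} V^{(j)} \otimes R_s \otimes V^{(n_s(i)-s-j)}$. The left multi-Koszul complex of $A$ is $K(A)_i = A \otimes J_i$, with $\delta_1(\alpha \otimes v) = \alpha v$ and, for $i \geq 2$, with $\delta_i : A \otimes J_i \to A \otimes J_{i-1}$ given on $A \otimes J_i^s$ by the restriction of $$\alpha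 \otimes v_1 \cdots v_{n_s(i)} \mapsto \begin{cases} \alpha v_1 \cdots v_{s-1} \otimes v_s \cdots v_{n_s(i)}, & i \text{ even},\\ \alpha v_1 \otimes v_2 \cdots v_{n_s(i)}, & i \text{ odd}.\end{cases}$$ Assume that $A$ is multi-Koszul, i.e. that this complex, augmented by $A \to k$, is exact (so that it is a free resolution of the trivial left $A$-module $k$). For an augmented $k$-algebra $B$ let $E(B) = \bigoplus_{n \geq 0} \mathrm{Ext}_B^n(k,k)$ be its Yoneda algebra, graded by the cohomological degree; restriction of scalars along a morphism of augmented algebras $B \to B'$ induces a morphism of graded algebras $E(B') \to E(B)$. Let $p_s : E(A) \to E(A^s)$, $q_s : E(A^s) \to E(T(V))$ and $r : E(A) \to E(T(V))$ be induced by the canonical projections $A^s \to A$, $T(V) \to A^s$ and $T(V) \to A$. Then $E(A)$, with the morphisms $p_s$ ($s \in S$) and $r$, is the inverse limit in the category of graded algebras of the diagram $\{ q_s : E(A^s) \to E(T(V)) \}_{s \in S}$: one has $q_s \circ p_s = r$ for all $s \in S$, and for every $\mathbb{N}_0$-graded $k$-algebra $B$ and all morphisms of graded algebras $f_s : B \to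 E(A^s)$ ($s \in S$) and $g : B \to E(T(V))$ with $q_s \circ f_s = g$ for all $s \in S$ there is a unique morphism of graded algebras $h : B \to E(A)$ with $p_s \circ h = f_s$ for all $s \in S$ and $r \circ h = g$. Moreover, each $q_s$ is the projection onto the cohomological degrees $\leq 1$: it vanishes on $E^n(A^s)$ for $n \geq 2$ and restricts to a bijection $E^0(A^s) \oplus E^1(A^s) \to E(T(V))$. -/

import Mathlib

namespace MultiKoszul

open CategoryTheory CategoryTheory.Abelian
open scoped TensorProduct DirectSum

section ExtAlgebra
universe w v v' u u' t

variable {C : Type u} [Category.{v} C] [Abelian C] [HasExt.{w} C]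

/-- The family of groups `Ext^n(X, X)`. -/
abbrev SelfExt (X : C) (n : ℕ) : Type w := Ext.{w} X X n

/-- The Yoneda product `α ∘ β` of `α ∈ Ext^a(X, X)` and `β ∈ Ext^b(X, X)`. -/
noncomputable def SelfExt.mul {X : C} {a b : ℕ} (α : SelfExt X a) (β : SelfExt X b) :
    SelfExt X (a + b) :=
  β.comp α (add_comm b a)

/-- The class of the identity in `Ext^0(X, X)`. -/
noncomputable def SelfExt.one (X : C) : SelfExt X 0 := Ext.mk₀ (𝟙 X)

lemma SelfExt.mk_eq {X : C} {a b : ℕ} (h : a = b) (α : SelfExt X a) (β : SelfExt X b)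
    (hαβ : α.comp (Ext.mk₀ (𝟙 X)) ((add_zero a).trans h) = β) :
    (GradedMonoid.mk a α : GradedMonoid (SelfExt X)) = GradedMonoid.mk b β := by
  subst h
  rw [Ext.comp_mk₀_id] at hαβ
  rw [hαβ]

lemma SelfExt.one_mul' {X : C} {a : ℕ} (α : SelfExt X a) :
    (GradedMonoid.mk _ (SelfExt.mul (SelfExt.one X) α) : GradedMonoid (SelfExt X)) =
      GradedMonoid.mk a α := by
  refine SelfExt.mk_eq (zero_add a) _ _ ?_
  rw [SelfExt.mul, SelfExt.one, Ext.comp_assoc _ _ _ _ (add_zero 0) (by lia), Ext.mk₀_comp_mk₀]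
  simp only [Category.comp_id, Ext.comp_mk₀_id]

lemma SelfExt.mul_one' {X : C} {a : ℕ} (α : SelfExt X a) :
    (GradedMonoid.mk _ (SelfExt.mul α (SelfExt.one X)) : GradedMonoid (SelfExt X)) =
      GradedMonoid.mk a α := by
  refine SelfExt.mk_eq (add_zero a) _ _ ?_
  rw [SelfExt.mul, SelfExt.one, Ext.comp_mk₀_id, Ext.mk₀_id_comp]

lemma SelfExt.mul_assoc' {X : C} {a b c : ℕ} (α : SelfExt X a) (β : SelfExt X b)
    (γ : SelfExt X c) :
    (GradedMonoid.mk _ (SelfExt.mul (SelfExt.mul α β) γ) : GradedMonoid (SelfExt X)) =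
      GradedMonoid.mk _ (SelfExt.mul α (SelfExt.mul β γ)) := by
  refine SelfExt.mk_eq (add_assoc a b c) _ _ ?_
  simp only [SelfExt.mul]
  rw [Ext.comp_assoc _ _ _ _ (add_zero _) (by lia), Ext.comp_mk₀_id,
    Ext.comp_assoc γ β α _ _ (by lia)]

noncomputable instance (X : C) : GradedMonoid.GOne (SelfExt X) := ⟨SelfExt.one X⟩

noncomputable instance (X : C) : GradedMonoid.GMul (SelfExt X) := ⟨SelfExt.mul⟩

noncomputable instance (X : C) : GradedMonoid.GMonoid (SelfExt X) where
  one_mul x := SelfExt.one_mul' x.2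
  mul_one x := SelfExt.mul_one' x.2
  mul_assoc x y z := SelfExt.mul_assoc' x.2 y.2 z.2

noncomputable instance (X : C) : DirectSum.GRing (SelfExt X) where
  mul_zero {i j} α := Ext.zero_comp (n := j) X α (i + j) (add_comm j i)
  zero_mul {i j} β := Ext.comp_zero β X i (i + j) (add_comm j i)
  mul_add {i j} α β γ := Ext.add_comp β γ α (add_comm j i)
  add_mul {i j} α β γ := Ext.comp_add γ α β (add_comm j i)
  natCast n := n • SelfExt.one X
  natCast_zero := zero_smul _ _
  natCast_succ n := succ_nsmul _ n
  intCast n := n • SelfExt.one X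
  intCast_ofNat n := natCast_zsmul _ n
  intCast_negSucc_ofNat n := negSucc_zsmul _ n

variable (k : Type t) [Field k] [Linear k C]

lemma SelfExt.smul_one_mul {X : C} {a : ℕ} (r : k) (α : SelfExt X a) :
    (GradedMonoid.mk _ (SelfExt.mul (r • SelfExt.one X) α) : GradedMonoid (SelfExt X)) =
      GradedMonoid.mk a (r • α) := by
  refine SelfExt.mk_eq (zero_add a) _ _ ?_
  rw [SelfExt.mul, SelfExt.one, Ext.comp_smul, Ext.smul_comp,
    Ext.comp_assoc _ _ _ _ (add_zero 0) (by lia), Ext.mk₀_comp_mk₀]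
  simp only [Category.comp_id, Ext.comp_mk₀_id]

lemma SelfExt.mul_smul_one {X : C} {a : ℕ} (r : k) (α : SelfExt X a) :
    (GradedMonoid.mk _ (SelfExt.mul α (r • SelfExt.one X)) : GradedMonoid (SelfExt X)) =
      GradedMonoid.mk a (r • α) := by
  refine SelfExt.mk_eq (add_zero a) _ _ ?_
  rw [SelfExt.mul, SelfExt.one, Ext.comp_mk₀_id, Ext.smul_comp, Ext.mk₀_id_comp]

noncomputable instance (X : C) : DirectSum.GAlgebra k (SelfExt X) where
  toFun :=
    { toFun c := c • SelfExt.one X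
      map_zero' := zero_smul _ _
      map_add' _ _ := add_smul _ _ _ }
  map_one := one_smul _ _
  map_mul r s := by
    refine Eq.trans ?_ (SelfExt.smul_one_mul k r (s • SelfExt.one X)).symm
    exact congrArg (GradedMonoid.mk 0) (mul_smul _ _ _)
  commutes r x := (SelfExt.smul_one_mul k r x.2).trans (SelfExt.mul_smul_one k r x.2).symm
  smul_def r x := (SelfExt.smul_one_mul k r x.2).symm

/-- The algebra `⨁ n, Ext^n(X, X)` with the Yoneda product. -/
abbrev ExtAlgebra (X : C) : Type w := ⨁ n, SelfExt X n

/-- The grading of `⨁ n, Ext^n(X, X)` by the cohomological degree. -/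
noncomputable def extGrading (X : C) (n : ℕ) : Submodule k (ExtAlgebra X) :=
  LinearMap.range (DirectSum.lof k ℕ (SelfExt X) n)

noncomputable instance (X : C) : GradedAlgebra (extGrading k X) where
  one_mem := ⟨SelfExt.one X, rfl⟩
  mul_mem := by
    rintro a b _ _ ⟨α, rfl⟩ ⟨β, rfl⟩
    exact ⟨SelfExt.mul α β, (DirectSum.of_mul_of α β).symm⟩
  toDecomposition := DirectSum.Decomposition.ofLinearMap (extGrading k X)
    (DirectSum.toModule k ℕ _ fun n =>
      (DirectSum.lof k ℕ (fun i => extGrading k X i) n) ∘ₗ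
        (DirectSum.lof k ℕ (SelfExt X) n).rangeRestrict)
    (by
      refine DirectSum.linearMap_ext _ fun n => LinearMap.ext fun α => ?_
      simp only [LinearMap.comp_apply, DirectSum.toModule_lof, LinearMap.id_apply]
      exact DirectSum.coeLinearMap_lof (extGrading k X) n
        ((DirectSum.lof k ℕ (SelfExt X) n).rangeRestrict α))
    (by
      refine DirectSum.linearMap_ext _ fun n => LinearMap.ext ?_
      rintro ⟨_, ⟨α, rfl⟩⟩
      simp only [LinearMap.comp_apply, LinearMap.id_apply]
      rw [DirectSum.coeLinearMap_lof (extGrading k X)]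
      exact DirectSum.toModule_lof k n α)

variable {k}
variable {D : Type u'} [Category.{v'} D] [Abelian D] [HasExt.{w} D] [Linear k D]

/-- The map `Ext^n(X, X) → Ext^n(F X, F X) ≃ Ext^n(Y, Y)` induced by an exact functor `F` and an
isomorphism `F X ≅ Y`. -/
noncomputable def SelfExt.map (F : C ⥤ D) [F.Additive] [F.Linear k] [Limits.PreservesFiniteLimits F]
    [Limits.PreservesFiniteColimits F] {X : C} {Y : D} (e : F.obj X ≅ Y) (n : ℕ) :
    SelfExt X n →ₗ[k] SelfExt Y n where
  toFun α := (Ext.mk₀ e.inv).comp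
    ((α.mapExactFunctor F).comp (Ext.mk₀ e.hom) (add_zero n)) (zero_add n)
  map_add' α β := by
    rw [Ext.mapExactFunctor_add, Ext.add_comp, Ext.comp_add]
  map_smul' c α := by
    rw [Functor.mapExactFunctor_smul, Ext.smul_comp, Ext.comp_smul, RingHom.id_apply]

section
variable (F : C ⥤ D) [F.Additive] [F.Linear k] [Limits.PreservesFiniteLimits F]
    [Limits.PreservesFiniteColimits F] {X : C} {Y : D} (e : F.obj X ≅ Y)

lemma SelfExt.map_one : SelfExt.map (k := k) F e 0 (SelfExt.one X) = SelfExt.one Y := by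
  change (Ext.mk₀ e.inv).comp ((Ext.mapExactFunctor F (Ext.mk₀ (𝟙 X))).comp
    (Ext.mk₀ e.hom) (add_zero 0)) (zero_add 0) = Ext.mk₀ (𝟙 Y)
  rw [Ext.mapExactFunctor_mk₀]
  simp

lemma SelfExt.map_mul {a b : ℕ} (α : SelfExt X a) (β : SelfExt X b) :
    SelfExt.map (k := k) F e (a + b) (SelfExt.mul α β) =
      SelfExt.mul (SelfExt.map (k := k) F e a α) (SelfExt.map (k := k) F e b β) := by
  change (Ext.mk₀ e.inv).comp ((Ext.mapExactFunctor F (β.comp α (add_comm b a))).comp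
      (Ext.mk₀ e.hom) (add_zero _)) (zero_add _) =
    Ext.comp ((Ext.mk₀ e.inv).comp ((β.mapExactFunctor F).comp (Ext.mk₀ e.hom) (add_zero _))
      (zero_add _)) ((Ext.mk₀ e.inv).comp ((α.mapExactFunctor F).comp (Ext.mk₀ e.hom) (add_zero _))
      (zero_add _)) (add_comm b a)
  rw [Ext.mapExactFunctor_comp]
  generalize β.mapExactFunctor F = β'
  generalize α.mapExactFunctor F = α'
  rw [Ext.comp_assoc (Ext.mk₀ e.inv) _ _ _ (add_comm b a) (by lia),
    Ext.comp_assoc β' (Ext.mk₀ e.hom) _ _ (zero_add a) (by lia),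
    Ext.mk₀_comp_mk₀_assoc, e.hom_inv_id, Ext.mk₀_id_comp,
    Ext.comp_assoc β' α' _ _ (add_zero a) (by lia)]

/-- The morphism of graded algebras `⨁ n, Ext^n(X, X) → ⨁ n, Ext^n(Y, Y)` induced by an exact
functor `F` and an isomorphism `F X ≅ Y`. -/
noncomputable def ExtAlgebra.map : extGrading k X →ₐᵍ[k] extGrading k Y where
  toAlgHom := DirectSum.toAlgebra k (SelfExt X)
    (fun n => DirectSum.lof k ℕ (SelfExt Y) n ∘ₗ SelfExt.map F e n)
    (congrArg (DirectSum.of (SelfExt Y) 0) (SelfExt.map_one F e))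
    (fun {a b} α β => (congrArg (DirectSum.of (SelfExt Y) (a + b))
      (SelfExt.map_mul F e α β)).trans (DirectSum.of_mul_of _ _).symm)
  map_mem := by
    rintro n _ ⟨α, rfl⟩
    exact ⟨SelfExt.map F e n α, (DirectSum.toAddMonoid_of
      (fun n => (DirectSum.lof k ℕ (SelfExt Y) n ∘ₗ SelfExt.map F e n).toAddMonoidHom) n α).symm⟩

lemma ExtAlgebra.map_lof (n : ℕ) (α : SelfExt X n) :
    ExtAlgebra.map (k := k) F e (DirectSum.lof k ℕ (SelfExt X) n α) =
      DirectSum.lof k ℕ (SelfExt Y) n (SelfExt.map (k := k) F e n α) :=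
  DirectSum.toAddMonoid_of
    (fun n => (DirectSum.lof k ℕ (SelfExt Y) n ∘ₗ SelfExt.map F e n).toAddMonoidHom) n α

end

end ExtAlgebra

section Yoneda
universe u

variable {k : Type u} [Field k] {A B : Type u} [Ring A] [Algebra k A] [Ring B] [Algebra k B]

/-- The trivial left `A`-module `k` of an augmented algebra `ε : A → k`. -/
noncomputable abbrev trivialModule (ε : A →ₐ[k] k) : ModuleCat.{u} A :=
  (ModuleCat.restrictScalars ε.toRingHom).obj (ModuleCat.of k k)

/-- The Yoneda algebra `E(A) = ⨁ n, Ext_A^n(k, k)` of an augmented algebra `ε : A → k`. -/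
abbrev YonedaAlgebra (ε : A →ₐ[k] k) : Type u := ExtAlgebra (trivialModule ε)

/-- The cohomological grading of the Yoneda algebra. -/
noncomputable abbrev yonedaGrading (ε : A →ₐ[k] k) : ℕ → Submodule k (YonedaAlgebra ε) :=
  extGrading k (trivialModule ε)

/-- Restriction of scalars is left exact. -/
instance restrictScalars_preservesFiniteLimits (φ : A →+* B) :
    Limits.PreservesFiniteLimits (ModuleCat.restrictScalars.{u} φ) := by
  have : Limits.PreservesLimitsOfSize.{0, 0}
      (ModuleCat.restrictScalars.{u} φ ⋙ forget₂ (ModuleCat.{u} A) AddCommGrpCat.{u}) :=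
    inferInstanceAs (Limits.PreservesLimitsOfSize.{0, 0}
      (forget₂ (ModuleCat.{u} B) AddCommGrpCat.{u}))
  have : Limits.PreservesLimitsOfSize.{0, 0} (ModuleCat.restrictScalars.{u} φ) :=
    Limits.preservesLimits_of_reflects_of_preserves _ (forget₂ (ModuleCat.{u} A) AddCommGrpCat.{u})
  exact Limits.PreservesLimitsOfSize.preservesFiniteLimits _

/-- Restriction of scalars along a morphism of augmented algebras `φ : A → B` sends the trivial
`B`-module to the trivial `A`-module. -/
noncomputable def trivialModuleIso {εA : A →ₐ[k] k} {εB : B →ₐ[k] k} (φ : A →ₐ[k] B)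
    (h : εB.comp φ = εA) :
    (ModuleCat.restrictScalars φ.toRingHom).obj (trivialModule εB) ≅ trivialModule εA :=
  (ModuleCat.restrictScalarsComp'App φ.toRingHom εB.toRingHom εA.toRingHom
      (by rw [← h]; rfl) (ModuleCat.of k k)).symm

/-- A morphism of augmented algebras `φ : A → B` induces a morphism of graded algebras
`E(B) → E(A)`, given by restriction of scalars along `φ`. -/
noncomputable def yonedaAlgebraMap {εA : A →ₐ[k] k} {εB : B →ₐ[k] k} (φ : A →ₐ[k] B)
    (h : εB.comp φ = εA) : yonedaGrading εB →ₐᵍ[k] yonedaGrading εA :=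
  ExtAlgebra.map (k := k) (C := ModuleCat.{u} B) (D := ModuleCat.{u} A)
    (ModuleCat.restrictScalars φ.toRingHom) (trivialModuleIso φ h)

end Yoneda

section Tensor
universe u v w

variable (k : Type u) [Field k] (V : Type v) [AddCommGroup V] [Module k V]

/-- The homogeneous component `V^{⊗ n}` of the tensor algebra. -/
noncomputable abbrev tensorPow (n : ℕ) : Submodule k (TensorAlgebra k V) :=
  LinearMap.range (TensorAlgebra.ι k : V →ₗ[k] TensorAlgebra k V) ^ n

variable {k V}

/-- The two-sided ideal of the tensor algebra generated by a subspace `R`. -/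
noncomputable abbrev relIdeal (R : Submodule k (TensorAlgebra k V)) : Ideal (TensorAlgebra k V) :=
  (TwoSidedIdeal.span (R : Set (TensorAlgebra k V))).asIdeal

/-- The algebra `T(V)/⟨R⟩`. -/
abbrev QuotAlg (R : Submodule k (TensorAlgebra k V)) : Type (max u v) :=
  TensorAlgebra k V ⧸ relIdeal R

/-- The projection `T(V) → T(V)/⟨R⟩`. -/
noncomputable abbrev QuotAlg.mk (R : Submodule k (TensorAlgebra k V)) :
    TensorAlgebra k V →ₐ[k] QuotAlg R :=
  Ideal.Quotient.mkₐ k (relIdeal R)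

lemma relIdeal_mono {R R' : Submodule k (TensorAlgebra k V)} (h : R ≤ R') :
    relIdeal R ≤ relIdeal R' :=
  TwoSidedIdeal.asIdeal.monotone (TwoSidedIdeal.span_mono h)

/-- The canonical projection `T(V)/⟨R⟩ → T(V)/⟨R'⟩` for `R ⊆ R'`. -/
noncomputable abbrev QuotAlg.factor {R R' : Submodule k (TensorAlgebra k V)} (h : R ≤ R') :
    QuotAlg R →ₐ[k] QuotAlg R' :=
  Ideal.Quotient.factorₐ k (relIdeal_mono h)

lemma eq_zero_of_mem_relIdeal {R : Submodule k (TensorAlgebra k V)} {B : Type w} [Ring B]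
    [Algebra k B] (f : TensorAlgebra k V →ₐ[k] B) (hR : ∀ x ∈ R, f x = 0)
    (x : TensorAlgebra k V) (hx : x ∈ relIdeal R) : f x = 0 := by
  have h : TwoSidedIdeal.span (R : Set (TensorAlgebra k V)) ≤ TwoSidedIdeal.ker f :=
    TwoSidedIdeal.span_le.2 fun y hy => (TwoSidedIdeal.mem_ker f).2 (hR y hy)
  exact (TwoSidedIdeal.mem_ker f).1 (h (TwoSidedIdeal.mem_asIdeal.1 hx))

/-- The augmentation `T(V) → k`, which vanishes on `V`. -/
noncomputable abbrev tensorAug : TensorAlgebra k V →ₐ[k] k := TensorAlgebra.algebraMapInv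

lemma tensorAug_eq_zero {n : ℕ} (hn : n ≠ 0) (x : TensorAlgebra k V) (hx : x ∈ tensorPow k V n) :
    tensorAug x = 0 := by
  obtain ⟨m, rfl⟩ := Nat.exists_eq_succ_of_ne_zero hn
  rw [tensorPow, pow_succ] at hx
  refine Submodule.mul_induction_on hx ?_ ?_
  · rintro a - _ ⟨v, rfl⟩
    simp [TensorAlgebra.algebraMapInv]
  · intro a b ha hb
    rw [map_add, ha, hb, add_zero]

/-- The augmentation `T(V)/⟨R⟩ → k` when `R` lies in the augmentation ideal. -/
noncomputable def QuotAlg.aug (R : Submodule k (TensorAlgebra k V))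
    (hR : ∀ x ∈ R, tensorAug x = 0) : QuotAlg R →ₐ[k] k :=
  Ideal.Quotient.liftₐ (relIdeal R) tensorAug (eq_zero_of_mem_relIdeal tensorAug hR)

section Shift
variable {A : Type w} [Ring A] [Algebra k A] (p : TensorAlgebra k V →ₐ[k] A)

/-- The action of the tensor algebra on `T(V) × (A ⊗ T(V))` in which `v ∈ V` sends `(x, y)` to
`(v x, p(v) ⊗ x)`. -/
noncomputable def shiftAction : TensorAlgebra k V →ₐ[k]
    Module.End k (TensorAlgebra k V × (A ⊗[k] TensorAlgebra k V)) :=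
  TensorAlgebra.lift k
    { toFun v := LinearMap.prod
        (LinearMap.mulLeft k (TensorAlgebra.ι k v) ∘ₗ LinearMap.fst k _ _)
        (TensorProduct.mk k A (TensorAlgebra k V) (p (TensorAlgebra.ι k v)) ∘ₗ
          LinearMap.fst k _ _)
      map_add' v v' := by
        ext x <;> simp [add_mul]
      map_smul' c v := by
        ext x <;> simp [TensorProduct.smul_tmul'] }

lemma shiftAction_ι (v : V) (z : TensorAlgebra k V × (A ⊗[k] TensorAlgebra k V)) :
    shiftAction p (TensorAlgebra.ι k v) z =
      (TensorAlgebra.ι k v * z.1, p (TensorAlgebra.ι k v) ⊗ₜ[k] z.1) := by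
  simp [shiftAction]

/-- The linear map `T(V) → A ⊗ T(V)` with `v₁ ⋯ vₙ ↦ p(v₁) ⊗ v₂ ⋯ vₙ` for `n ≥ 1` and `1 ↦ 0`. -/
noncomputable def splitFirst : TensorAlgebra k V →ₗ[k] A ⊗[k] TensorAlgebra k V :=
  LinearMap.snd k _ _ ∘ₗ LinearMap.applyₗ (1, 0) ∘ₗ (shiftAction p).toLinearMap

lemma shiftAction_fst (x : TensorAlgebra k V) :
    (shiftAction p x (1, 0)).1 = x := by
  suffices h : ∀ z, (shiftAction p x z).1 = x * z.1 by simpa using h (1, 0)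
  induction x using TensorAlgebra.induction with
  | algebraMap r => intro z; simp [Module.algebraMap_end_apply, Algebra.smul_def]
  | ι v => intro z; rw [shiftAction_ι]
  | mul a b ha hb => intro z; rw [map_mul, Module.End.mul_apply, ha, hb, mul_assoc]
  | add a b ha hb => intro z; rw [map_add, LinearMap.add_apply, Prod.fst_add, ha, hb, add_mul]

lemma splitFirst_one : splitFirst p 1 = 0 := by
  simp [splitFirst]

lemma splitFirst_ι_mul (v : V) (x : TensorAlgebra k V) :
    splitFirst p (TensorAlgebra.ι k v * x) = p (TensorAlgebra.ι k v) ⊗ₜ[k] x := by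
  change (shiftAction p (TensorAlgebra.ι k v * x) (1, 0)).2 = _
  rw [map_mul, Module.End.mul_apply, shiftAction_ι, shiftAction_fst]

/-- The left `A`-linear map `A ⊗ T(V) → A ⊗ T(V)` with
`α ⊗ v₁ ⋯ vₙ ↦ α p(v₁) ⊗ v₂ ⋯ vₙ` for `n ≥ 1` and `α ⊗ 1 ↦ 0`. -/
noncomputable def shift : A ⊗[k] TensorAlgebra k V →ₗ[A] A ⊗[k] TensorAlgebra k V :=
  TensorProduct.AlgebraTensorModule.lift
    { toFun α := α • splitFirst p
      map_add' α β := add_smul α β _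
      map_smul' α β := mul_smul α β _ }

lemma shift_tmul_one (α : A) : shift p (α ⊗ₜ[k] 1) = 0 := by
  simp [shift, splitFirst_one]

lemma shift_tmul_ι_mul (α : A) (v : V) (x : TensorAlgebra k V) :
    shift p (α ⊗ₜ[k] (TensorAlgebra.ι k v * x)) = (α * p (TensorAlgebra.ι k v)) ⊗ₜ[k] x := by
  simp [shift, splitFirst_ι_mul, TensorProduct.smul_tmul']

end Shift

end Tensor

universe u v

/-- A presentation of a multi-homogeneous algebra: a finite set `S` of degrees `≥ 2` and
subspaces `R s ⊆ V^{⊗ s}`, for `s ∈ S`, satisfying the minimality condition. (The values `R s` for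
`s ∉ S` play no role.) -/
structure Presentation (k : Type u) [Field k] (V : Type v) [AddCommGroup V] [Module k V] where
  /-- The degrees of the relations. -/
  S : Finset ℕ
  /-- The spaces of relations. -/
  R : ℕ → Submodule k (TensorAlgebra k V)
  two_le : ∀ s ∈ S, 2 ≤ s
  R_le : ∀ s ∈ S, R s ≤ tensorPow k V s
  minimal : ∀ s ∈ S, R s ⊓ (⨆ t ∈ S, ⨆ (_ : t < s), ⨆ j ∈ Finset.range (s - t + 1),
    tensorPow k V j * R t * tensorPow k V (s - t - j)) = ⊥

namespace Presentation

section
variable {k : Type u} [Field k] {V : Type v} [AddCommGroup V] [Module k V] (P : Presentation k V)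

/-- The space of relations `R = ⨁ s ∈ S, R s`. -/
noncomputable def rel : Submodule k (TensorAlgebra k V) := ⨆ s ∈ P.S, P.R s

lemma R_le_rel {s : ℕ} (hs : s ∈ P.S) : P.R s ≤ P.rel := le_iSup₂_of_le s hs le_rfl

/-- The algebra `A = T(V)/⟨R⟩`. -/
abbrev Alg : Type (max u v) := QuotAlg P.rel

/-- The algebra `A^s = T(V)/⟨R s⟩`. -/
abbrev AlgS (s : P.S) : Type (max u v) := QuotAlg (P.R s)

lemma tensorAug_R {s : ℕ} (hs : s ∈ P.S) (x : TensorAlgebra k V) (hx : x ∈ P.R s) :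
    tensorAug x = 0 :=
  tensorAug_eq_zero (by have := P.two_le s hs; lia) x (P.R_le s hs hx)

lemma tensorAug_rel (x : TensorAlgebra k V) (hx : x ∈ P.rel) : tensorAug x = 0 := by
  have h : P.rel ≤ LinearMap.ker (tensorAug : TensorAlgebra k V →ₐ[k] k).toLinearMap :=
    iSup₂_le fun s hs y hy => P.tensorAug_R hs y hy
  exact h hx

/-- The augmentation of `A`. -/
noncomputable abbrev aug : P.Alg →ₐ[k] k := QuotAlg.aug P.rel P.tensorAug_rel

/-- The augmentation of `A^s`. -/
noncomputable abbrev augS (s : P.S) : P.AlgS s →ₐ[k] k :=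
  QuotAlg.aug (P.R s) (P.tensorAug_R s.2)

/-- The function `n_s`, with `n_s(2l) = s l` and `n_s(2l+1) = s l + 1`. -/
def deg (s i : ℕ) : ℕ := s * (i / 2) + i % 2

/-- The spaces `J_i^s`, with `J_0^s = k`, `J_1^s = V` and
`J_i^s = ⋂ j, V^{⊗ j} ⊗ R_s ⊗ V^{⊗ (n_s(i) - s - j)}` (`0 ≤ j ≤ n_s(i) - s`) for `i ≥ 2`, as
subspaces of the tensor algebra. -/
noncomputable def JS (s : ℕ) : ℕ → Submodule k (TensorAlgebra k V)
  | 0 => tensorPow k V 0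
  | 1 => tensorPow k V 1
  | i + 2 => ⨅ j ∈ Finset.range (deg s (i + 2) - s + 1),
      tensorPow k V j * P.R s * tensorPow k V (deg s (i + 2) - s - j)

/-- The spaces `J_i`, with `J_0 = k`, `J_1 = V` and `J_i = ⨁ s ∈ S, J_i^s` for `i ≥ 2`; the sum is
direct because `J_i^s` lies in degree `n_s(i)` of the tensor algebra. -/
noncomputable def J : ℕ → Submodule k (TensorAlgebra k V)
  | 0 => tensorPow k V 0
  | 1 => tensorPow k V 1
  | i + 2 => ⨆ s ∈ P.S, P.JS s (i + 2)

/-- The term `K(A)_i = A ⊗ J_i` of the left multi-Koszul complex, as an `A`-submodule of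
`A ⊗ T(V)`. -/
noncomputable def K (i : ℕ) : Submodule P.Alg (P.Alg ⊗[k] TensorAlgebra k V) :=
  LinearMap.range ((P.J i).subtype.baseChange P.Alg)

/-- The projection of `A ⊗ T(V)` onto `A ⊗ V^{⊗ n}`. -/
noncomputable def projDeg (n : ℕ) :
    P.Alg ⊗[k] TensorAlgebra k V →ₗ[P.Alg] P.Alg ⊗[k] TensorAlgebra k V :=
  (GradedAlgebra.proj (tensorPow k V) n).baseChange P.Alg

/-- The differential `δ_i` (`i ≥ 1`) of the left multi-Koszul complex, as a map on all of
`A ⊗ T(V)`: `δ_1(α ⊗ v) = α v ⊗ 1` and, for `i ≥ 2`, on the component of degree `n_s(i)`,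
`δ_i(α ⊗ v_1 ⋯ v_n) = α v_1 ⋯ v_{s-1} ⊗ v_s ⋯ v_n` for `i` even and
`δ_i(α ⊗ v_1 ⋯ v_n) = α v_1 ⊗ v_2 ⋯ v_n` for `i` odd. (`δ_0` is the augmentation, see
`augComplex`.) -/
noncomputable def δ : ℕ → (P.Alg ⊗[k] TensorAlgebra k V →ₗ[P.Alg] P.Alg ⊗[k] TensorAlgebra k V)
  | 0 => 0
  | 1 => shift (QuotAlg.mk P.rel)
  | i + 2 => ∑ s ∈ P.S,
      (shift (QuotAlg.mk P.rel) ^ (if Even i then s - 1 else 1)) ∘ₗ P.projDeg (deg s (i + 2))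

/-- The augmentation of the left multi-Koszul complex, `α ⊗ c ↦ ε(α) c` on `K(A)_0 = A ⊗ k`. -/
noncomputable def augComplex : P.Alg ⊗[k] TensorAlgebra k V →ₗ[k] k :=
  LinearMap.mul' k k ∘ₗ TensorProduct.map P.aug.toLinearMap tensorAug.toLinearMap

/-- `A` is (left) multi-Koszul: the augmented left multi-Koszul complex
`⋯ → K(A)_2 → K(A)_1 → K(A)_0 → k → 0`, whose terms are free, is exact. -/
structure IsMultiKoszul : Prop where
  exact_zero : ∀ x ∈ P.K 0, P.augComplex x = 0 ↔ x ∈ (P.K 1).map (P.δ 1)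
  exact_succ : ∀ i, ∀ x ∈ P.K (i + 1), P.δ (i + 1) x = 0 ↔ x ∈ (P.K (i + 2)).map (P.δ (i + 2))

end

section
variable {k : Type u} [Field k] {V : Type u} [AddCommGroup V] [Module k V] (P : Presentation k V)

/-- The morphism of graded algebras `p_s : E(A) → E(A^s)` induced by `π_s : A^s → A`. -/
noncomputable def p (s : P.S) : yonedaGrading P.aug →ₐᵍ[k] yonedaGrading (P.augS s) :=
  yonedaAlgebraMap (QuotAlg.factor (P.R_le_rel s.2)) (Ideal.Quotient.algHom_ext _ (by ext; rfl))

/-- The morphism of graded algebras `q_s : E(A^s) → E(T(V))` induced by `ρ_s : T(V) → A^s`. -/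
noncomputable def q (s : P.S) :
    yonedaGrading (P.augS s) →ₐᵍ[k] yonedaGrading (tensorAug : TensorAlgebra k V →ₐ[k] k) :=
  yonedaAlgebraMap (QuotAlg.mk (P.R s)) (Ideal.Quotient.liftₐ_comp _ _ _)

/-- The morphism of graded algebras `E(A) → E(T(V))` induced by the projection `T(V) → A`. -/
noncomputable def r :
    yonedaGrading P.aug →ₐᵍ[k] yonedaGrading (tensorAug : TensorAlgebra k V →ₐ[k] k) :=
  yonedaAlgebraMap (QuotAlg.mk P.rel) (Ideal.Quotient.liftₐ_comp _ _ _)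

end

end Presentation

end MultiKoszul

universe u w

/-! Let `A ⊗ J n` be a free resolution of `k`, with `J n ⊆ T(V)`, whose differentials land in `A₊ ⊗
J n`. Every map to `k` kills `A₊ ⊗ J n`, so `Ext^n(k, k)` is the dual of `J n` (`coeff_injective`,
`exists_coeff_eq`). If `φ : A → B` is a map of augmented algebras and `φ ⊗ id` carries such a
resolution over `A`, with smaller spaces of generators, into one over `B`, then `E(B) → E(A)` is
restriction of functionals from the larger spaces to the smaller ones (`coeff_map`).

This is applied to three resolutions: over `T(V)` the generators are `k`, `V`, `0`, `0`, ...; over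
`A^s` they are the `J_n^s`; over `A` they are the `J_n`. In degrees `0` and `1` the generators
coincide, so all the maps are bijective there. In degrees `n ≥ 2` the `Ext` of `T(V)` vanishes, and
`J_n` is the direct sum of the `J_n^s` because these lie in distinct tensor degrees; hence the `p_s`
identify `Ext^n` over `A` with the product of the `Ext^n` over the `A^s`. The cone is thus a limit
of vector spaces in each degree. Joint injectivity of `r` and the `p_s` makes the degreewise lifts
multiplicative (`existsUnique_lift`).

The substantial point is that each `A^s` is Koszul, so that the `J_n^s` do resolve `k`. Splitting
the multi-Koszul complex by tensor degree gives exactness in degrees `≥ 2` of the Koszul complex of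
`A^s` after base change to `A` (`exact_koszulSpace`). This descends to `B = A^s`
(`exists_shift_pow_eq_of_quotient`) as follows. Let `I` be the kernel of `B → A` and `K` the Koszul
complex over `B`. Exactness of `K` in degree `1`, which holds for every presentation, and of its
base change to `A` in degree `2` give `Tor_1^B(I, k) = 0`. So the graded right `B`-module `I` is
free, on generators without component of degree `0`. Over `A` a cycle of `K` becomes a boundary, so
modulo boundaries it is a combination of these generators with coefficients in `K`; by freeness the
coefficients are again cycles, and only their components of smaller degree matter. Induction on the
degree concludes. -/

namespace MultiKoszul

open CategoryTheory CategoryTheory.Abelian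
open scoped TensorProduct DirectSum

/-! ### Dimension shifting along a minimal projective resolution. -/

section SyzygyChain
universe v v' u' t

/-- A projective resolution cut into short exact sequences
`0 ⟶ Z (n + 1) ⟶ X n ⟶ Z n ⟶ 0`; it resolves `Z 0`. -/
structure SyzygyChain (C : Type u) [Category.{v} C] [Abelian C] where
  /-- The syzygies. -/
  Z : ℕ → C
  /-- The projective objects of the resolution. -/
  X : ℕ → C
  /-- The inclusion of a syzygy. -/
  i : ∀ n, Z (n + 1) ⟶ X n
  /-- The projection onto a syzygy. -/
  π : ∀ n, X n ⟶ Z n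
  zero : ∀ n, i n ≫ π n = 0
  shortExact : ∀ n, (ShortComplex.mk (i n) (π n) (zero n)).ShortExact
  projective : ∀ n, Projective (X n)

namespace SyzygyChain

variable {C : Type u} [Category.{v} C] [Abelian C] [HasExt.{w} C] (K : SyzygyChain C)

/-- The class in `Ext^n(Z 0, Z n)` of the first `n` short exact sequences of the chain. -/
noncomputable def cls : ∀ n, Ext.{w} (K.Z 0) (K.Z n) n
  | 0 => Ext.mk₀ (𝟙 _)
  | n + 1 => (cls n).comp (K.shortExact n).extClass rfl

/-- The resolution is minimal with respect to `Y`: the differentials induce zero on `Hom(-, Y)`. -/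
def IsMinimalFor (Y : C) : Prop := ∀ n (f : K.X n ⟶ Y), K.i n ≫ f = 0

variable {K} {Y : C}

/-- Long exact sequence of `Ext(-, Y)`: the neighbouring terms are `Ext(X n, Y)`, which vanish in
positive degree by projectivity; in degree `0` the incoming map vanishes by minimality. The latter
is what makes the case `m = 0` bijective and not merely surjective. -/
lemma extClass_comp_bijective (hY : K.IsMinimalFor Y) (n m : ℕ) {r : ℕ} (h : 1 + m = r) :
    Function.Bijective fun α : Ext.{w} (K.Z (n + 1)) Y m => (K.shortExact n).extClass.comp α h := by
  have := K.projective n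
  constructor
  · intro α β hαβ
    rw [← sub_eq_zero]
    obtain ⟨γ, hγ⟩ := Ext.contravariant_sequence_exact₁ (K.shortExact n) Y (α - β) h
      ((map_sub ((K.shortExact n).extClass.precomp Y h) α β).trans (sub_eq_zero.2 hαβ))
    rw [← hγ]
    match m, γ with
    | 0, γ =>
      obtain ⟨f, rfl⟩ := (Ext.mk₀_bijective _ _).2 γ
      rw [Ext.mk₀_comp_mk₀]
      exact (congrArg Ext.mk₀ (hY n f)).trans (Ext.mk₀_zero _ _)
    | m + 1, γ => rw [Ext.eq_zero_of_projective γ, Ext.comp_zero]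
  · intro β
    obtain rfl : r = m + 1 := by lia
    refine Ext.contravariant_sequence_exact₃ (K.shortExact n) Y β ?_ h
    exact Ext.eq_zero_of_projective (P := K.X n) _

lemma cls_comp_bijective (hY : K.IsMinimalFor Y) :
    ∀ (n m : ℕ) {r : ℕ} (h : n + m = r),
      Function.Bijective fun α : Ext.{w} (K.Z n) Y m => (K.cls n).comp α h
  | 0, m, r, h => by
    obtain rfl : m = r := by lia
    convert Function.bijective_id using 2 with α
    exact Ext.mk₀_id_comp α
  | n + 1, m, r, h => by
    have h₁ := (cls_comp_bijective hY n (1 + m) (r := r) (by lia)).comp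
      (extClass_comp_bijective hY n m rfl)
    convert h₁ using 2 with α
    exact Ext.comp_assoc _ _ _ rfl rfl (by lia)

-- By minimality every map from `X n` to `Y` vanishes on the next syzygy and so descends to `Z n`.
omit [HasExt.{w} C] in
lemma π_comp_bijective (hY : K.IsMinimalFor Y) (n : ℕ) :
    Function.Bijective fun f : K.Z n ⟶ Y => K.π n ≫ f := by
  have := (K.shortExact n).epi_g
  dsimp at this
  refine ⟨fun f g h => (cancel_epi (K.π n)).1 h, fun f => ?_⟩
  exact ⟨(K.shortExact n).exact.desc f (hY n f), (K.shortExact n).exact.g_desc f (hY n f)⟩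

/-- For a minimal resolution, `Ext^n(Z 0, Y)` is `Hom(X n, Y)`. -/
noncomputable def extEquiv (hY : K.IsMinimalFor Y) (n : ℕ) : Ext.{w} (K.Z 0) Y n ≃ (K.X n ⟶ Y) :=
  ((Equiv.ofBijective _ (Ext.mk₀_bijective (K.Z n) Y)).trans
    (Equiv.ofBijective _ (cls_comp_bijective hY n 0 (add_zero n)))).symm.trans
    (Equiv.ofBijective _ (π_comp_bijective hY n))

lemma extEquiv_cls_comp (hY : K.IsMinimalFor Y) {n : ℕ} (f : K.Z n ⟶ Y) :
    extEquiv hY n ((K.cls n).comp (Ext.mk₀ f) (add_zero n)) = K.π n ≫ f := by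
  have h : (K.cls n).comp (Ext.mk₀ f) (add_zero n) =
      (Equiv.ofBijective _ (Ext.mk₀_bijective (K.Z n) Y)).trans
        (Equiv.ofBijective _ (cls_comp_bijective hY n 0 (add_zero n))) f := rfl
  rw [h, extEquiv, Equiv.trans_apply, Equiv.symm_apply_apply]
  rfl

lemma exists_cls_comp (hY : K.IsMinimalFor Y) {n : ℕ} (α : Ext.{w} (K.Z 0) Y n) :
    ∃ f : K.Z n ⟶ Y, (K.cls n).comp (Ext.mk₀ f) (add_zero n) = α := by
  obtain ⟨β, hβ⟩ := (cls_comp_bijective hY n 0 (add_zero n)).2 α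
  obtain ⟨f, rfl⟩ := (Ext.mk₀_bijective _ _).2 β
  exact ⟨f, hβ⟩

section Functor
variable {D : Type u'} [Category.{v'} D] [Abelian D] [HasExt.{w} D]
  (F : C ⥤ D) [F.Additive] [Limits.PreservesFiniteLimits F] [Limits.PreservesFiniteColimits F]
  (L : SyzygyChain D)

/-- Induction on `n`: a morphism of short exact sequences intertwines their extension classes, and
an exact functor sends the class of a sequence to the class of its image. -/
lemma cls_comp_map (x : ∀ n, L.X n ⟶ F.obj (K.X n)) (z : ∀ n, L.Z n ⟶ F.obj (K.Z n))
    (hi : ∀ n, L.i n ≫ x n = z (n + 1) ≫ F.map (K.i n))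
    (hπ : ∀ n, L.π n ≫ z n = x n ≫ F.map (K.π n)) :
    ∀ n, (Ext.mk₀ (z 0)).comp ((K.cls n).mapExactFunctor F) (zero_add n) =
      (L.cls n).comp (Ext.mk₀ (z n)) (add_zero n)
  | 0 => by
    change Ext.comp _ (Ext.mapExactFunctor F (Ext.mk₀ (𝟙 _))) _ = Ext.comp (Ext.mk₀ (𝟙 _)) _ _
    rw [Ext.mapExactFunctor_mk₀, Ext.mk₀_comp_mk₀, Ext.mk₀_comp_mk₀]
    simp
  | n + 1 => by
    let c : Ext.{w} (L.Z n) (L.Z (n + 1)) 1 := (L.shortExact n).extClass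
    let c' : Ext.{w} (F.obj (K.Z n)) (F.obj (K.Z (n + 1))) 1 :=
      ((K.shortExact n).map_of_exact F).extClass
    have hF : Ext.mapExactFunctor F ((K.cls n).comp (K.shortExact n).extClass rfl) =
        ((K.cls n).mapExactFunctor F).comp c' rfl := by
      rw [Ext.mapExactFunctor_comp]
      exact congrArg (fun y => Ext.comp _ y rfl) (Ext.mapExactFunctor_extClass F (K.shortExact n))
    have hn : c.comp (Ext.mk₀ (z (n + 1))) (add_zero 1) =
        (Ext.mk₀ (z n)).comp c' (zero_add 1) :=
      ShortComplex.ShortExact.extClass_naturality (L.shortExact n)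
        ((K.shortExact n).map_of_exact F)
        { τ₁ := z (n + 1), τ₂ := x n, τ₃ := z n, comm₁₂ := (hi n).symm, comm₂₃ := (hπ n).symm }
    change Ext.comp _ (Ext.mapExactFunctor F (Ext.comp (K.cls n) _ _)) _ =
      Ext.comp (Ext.comp (L.cls n) c _) _ _
    rw [hF, ← Ext.comp_assoc _ _ _ (zero_add n) rfl (by lia), cls_comp_map x z hi hπ n,
      Ext.comp_assoc _ _ _ (add_zero n) (zero_add 1) (by lia), ← hn,
      Ext.comp_assoc _ _ _ rfl (add_zero 1) (by lia)]

variable {k : Type t} [Field k] [Linear k C] [Linear k D] [F.Linear k] {L}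

/-- A comparison map of minimal resolutions computes the map on `Ext` of an exact functor. -/
lemma extEquiv_map (e : F.obj (K.Z 0) ≅ L.Z 0) (hK : K.IsMinimalFor (K.Z 0))
    (hL : L.IsMinimalFor (L.Z 0))
    (x : ∀ n, L.X n ⟶ F.obj (K.X n)) (z : ∀ n, L.Z n ⟶ F.obj (K.Z n)) (hz : z 0 = e.inv)
    (hi : ∀ n, L.i n ≫ x n = z (n + 1) ≫ F.map (K.i n))
    (hπ : ∀ n, L.π n ≫ z n = x n ≫ F.map (K.π n)) {n : ℕ} (α : SelfExt (K.Z 0) n) :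
    extEquiv hL n (SelfExt.map (k := k) F e n α) =
      x n ≫ F.map (extEquiv hK n α) ≫ e.hom := by
  obtain ⟨f, rfl⟩ := exists_cls_comp hK α
  rw [extEquiv_cls_comp]
  have h : SelfExt.map (k := k) F e n ((K.cls n).comp (Ext.mk₀ f) (add_zero n)) =
      (L.cls n).comp (Ext.mk₀ (z n ≫ F.map f ≫ e.hom)) (add_zero n) := by
    change (Ext.mk₀ e.inv).comp ((Ext.mapExactFunctor F _).comp (Ext.mk₀ e.hom) (add_zero n))
      (zero_add n) = _
    rw [Ext.mapExactFunctor_comp, Ext.mapExactFunctor_mk₀,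
      Ext.comp_assoc _ _ _ (add_zero n) (add_zero 0) (by lia), Ext.mk₀_comp_mk₀,
      ← Ext.comp_assoc _ _ _ (zero_add n) (add_zero n) (by lia), ← hz,
      cls_comp_map F L x z hi hπ n, Ext.comp_assoc _ _ _ (add_zero n) (zero_add 0) (by lia),
      Ext.mk₀_comp_mk₀]
  rw [h, extEquiv_cls_comp, ← Category.assoc, hπ, Functor.map_comp, Category.assoc, Category.assoc]

end Functor

end SyzygyChain

end SyzygyChain

/-! ### Minimal resolutions `A ⊗ J n` and functionals on their generators. -/

section FreeResolution

variable {k : Type u} [Field k] {V : Type u} [AddCommGroup V] [Module k V]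
variable {A : Type u} [Ring A] [Algebra k A]

lemma baseChange_induction {J : Submodule k (TensorAlgebra k V)}
    {motive : A ⊗[k] TensorAlgebra k V → Prop} (zero : motive 0)
    (tmul : ∀ a, ∀ x ∈ J, motive (a ⊗ₜ x))
    (add : ∀ x y, motive x → motive y → motive (x + y))
    {x : A ⊗[k] TensorAlgebra k V} (hx : x ∈ J.baseChange A) : motive x := by
  obtain ⟨y, rfl⟩ := hx
  induction y with
  | zero => rw [map_zero]; exact zero
  | tmul a j => exact tmul a _ j.2
  | add y z hy hz => rw [map_add]; exact add _ _ hy hz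

lemma baseChange_le {J : Submodule k (TensorAlgebra k V)}
    {N : Submodule A (A ⊗[k] TensorAlgebra k V)} (h : ∀ x ∈ J, 1 ⊗ₜ x ∈ N) :
    J.baseChange A ≤ N := fun _ hx =>
  baseChange_induction N.zero_mem (fun a x hx => by
    have := N.smul_mem a (h x hx)
    rwa [TensorProduct.smul_tmul', smul_eq_mul, mul_one] at this)
    (fun _ _ => N.add_mem) hx

instance projective_baseChange (J : Submodule k (TensorAlgebra k V)) :
    Module.Projective A (J.baseChange A) :=
  Module.Projective.of_equiv (LinearEquiv.ofInjective (J.subtype.baseChange A)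
    (Module.Flat.lTensor_preserves_injective_linearMap J.subtype J.subtype_injective))

lemma baseChange_hom_ext {J : Submodule k (TensorAlgebra k V)} {M : Type*} [AddCommGroup M]
    [Module A M] {f g : J.baseChange A →ₗ[A] M}
    (h : ∀ (x) (hx : x ∈ J), f ⟨1 ⊗ₜ x, Submodule.tmul_mem_baseChange_of_mem 1 hx⟩ =
      g ⟨1 ⊗ₜ x, Submodule.tmul_mem_baseChange_of_mem 1 hx⟩) : f = g := by
  have h' : J.baseChange A ≤ (LinearMap.eqLocus f g).map (J.baseChange A).subtype :=
    baseChange_le fun x hx => ⟨_, h x hx, rfl⟩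
  ext x
  obtain ⟨y, hy, hyx⟩ := h' x.2
  rwa [← Subtype.ext hyx]

variable (ε : A →ₐ[k] k)

/-- The `A`-linear map `ε ⊗ lam : A ⊗ T(V) → k` for a functional `lam` on `T(V)`. -/
noncomputable def functional (lam : TensorAlgebra k V →ₗ[k] k) :
    A ⊗[k] TensorAlgebra k V →ₗ[A] trivialModule ε where
  toFun x := (LinearMap.mul' k k ∘ₗ TensorProduct.map ε.toLinearMap lam : _ →ₗ[k] k) x
  map_add' := map_add _
  map_smul' a x := by
    change _ = ε a * (LinearMap.mul' k k ∘ₗ TensorProduct.map ε.toLinearMap lam : _ →ₗ[k] k) x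
    induction x with
    | zero => simp
    | tmul b t => simp [TensorProduct.smul_tmul', mul_assoc]
    | add x y hx hy => rw [smul_add, map_add, hx, hy, map_add, mul_add]

/-- The submodule `A₊ ⊗ J` of `A ⊗ T(V)`. -/
def positivePart (J : Submodule k (TensorAlgebra k V)) :
    Submodule A (A ⊗[k] TensorAlgebra k V) :=
  Submodule.span A {y | ∃ a, ε a = 0 ∧ ∃ x ∈ J, y = a ⊗ₜ x}

lemma positivePart_le (J : Submodule k (TensorAlgebra k V)) :
    positivePart ε J ≤ J.baseChange A := by
  refine Submodule.span_le.2 ?_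
  rintro _ ⟨a, -, x, hx, rfl⟩
  exact Submodule.tmul_mem_baseChange_of_mem a hx

/-- For `ε a = 0`, linearity gives `f (a ⊗ x) = ε a * f (1 ⊗ x) = 0`. This is the source of
minimality of all the resolutions below. -/
lemma map_positivePart_eq_zero {J : Submodule k (TensorAlgebra k V)}
    (f : J.baseChange A →ₗ[A] trivialModule ε) (x : J.baseChange A)
    (hx : (x : A ⊗[k] TensorAlgebra k V) ∈ positivePart ε J) : f x = 0 := by
  have h : positivePart ε J ≤ (LinearMap.ker f).map (J.baseChange A).subtype := by
    refine Submodule.span_le.2 ?_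
    rintro _ ⟨a, ha, x, hx, rfl⟩
    refine ⟨a • ⟨1 ⊗ₜ x, Submodule.tmul_mem_baseChange_of_mem 1 hx⟩, ?_, ?_⟩
    · rw [SetLike.mem_coe, LinearMap.mem_ker, map_smul]
      change ε a * _ = (0 : k)
      rw [ha]
      exact zero_mul (M₀ := k) _
    · simp [TensorProduct.smul_tmul']
  obtain ⟨y, hy, hyx⟩ := h hx
  rwa [← Subtype.ext hyx]

variable (V) in
/-- A minimal free resolution `⋯ → A ⊗ J 1 → A ⊗ J 0 → k → 0` of the trivial module of an augmented
algebra `A`, given by subspaces `J n` of `T(V)` with `J 0 = k`. -/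
structure FreeResolution where
  /-- The spaces of generators. -/
  J : ℕ → Submodule k (TensorAlgebra k V)
  /-- The differentials. -/
  d : ℕ → (A ⊗[k] TensorAlgebra k V →ₗ[A] A ⊗[k] TensorAlgebra k V)
  one_mem : 1 ∈ J 0
  d_mem : ∀ n, ∀ x ∈ J (n + 1), d n (1 ⊗ₜ x) ∈ positivePart ε (J n)
  exact_zero : ∀ x ∈ (J 0).baseChange A, functional ε tensorAug.toLinearMap x = 0 →
    ∃ y ∈ (J 1).baseChange A, d 0 y = x
  d_d : ∀ n, ∀ x ∈ J (n + 2), d n (d (n + 1) (1 ⊗ₜ x)) = 0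
  exact_succ : ∀ n, ∀ x ∈ (J (n + 1)).baseChange A, d n x = 0 →
    ∃ y ∈ (J (n + 2)).baseChange A, d (n + 1) y = x

namespace FreeResolution
variable {ε} (F : FreeResolution V ε)

lemma d_mem' (n : ℕ) {x : A ⊗[k] TensorAlgebra k V} (hx : x ∈ (F.J (n + 1)).baseChange A) :
    F.d n x ∈ positivePart ε (F.J n) := by
  have h : (F.J (n + 1)).baseChange A ≤ (positivePart ε (F.J n)).comap (F.d n) :=
    baseChange_le (F.d_mem n)
  exact h hx

lemma d_d' (n : ℕ) {x : A ⊗[k] TensorAlgebra k V} (hx : x ∈ (F.J (n + 2)).baseChange A) :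
    F.d n (F.d (n + 1) x) = 0 := by
  have h : (F.J (n + 2)).baseChange A ≤ LinearMap.ker (F.d n ∘ₗ F.d (n + 1)) :=
    baseChange_le (F.d_d n)
  exact h hx

/-- The submodule of boundaries. -/
def boundaries (n : ℕ) : Submodule A (A ⊗[k] TensorAlgebra k V) :=
  ((F.J (n + 1)).baseChange A).map (F.d n)

lemma boundaries_le_positivePart (n : ℕ) : F.boundaries n ≤ positivePart ε (F.J n) := by
  rintro _ ⟨x, hx, rfl⟩
  exact F.d_mem' n hx

lemma boundaries_le (n : ℕ) : F.boundaries n ≤ (F.J n).baseChange A :=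
  (F.boundaries_le_positivePart n).trans (positivePart_le ε _)

/-- The syzygies. -/
noncomputable def syz : ℕ → ModuleCat.{u} A
  | 0 => trivialModule ε
  | n + 1 => ModuleCat.of A (F.boundaries n)

/-- The projection onto a syzygy. -/
noncomputable def toSyz : ∀ n, (F.J n).baseChange A →ₗ[A] F.syz n
  | 0 => functional ε tensorAug.toLinearMap ∘ₗ Submodule.subtype _
  | n + 1 => (F.d n ∘ₗ Submodule.subtype _).codRestrict (F.boundaries n)
      fun x => ⟨x, x.2, rfl⟩

lemma toSyz_surjective : ∀ n, Function.Surjective (F.toSyz n)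
  | 0 => fun c => ⟨⟨algebraMap k A c ⊗ₜ 1,
      Submodule.tmul_mem_baseChange_of_mem _ F.one_mem⟩, by
      change ε (algebraMap k A c) * tensorAug 1 = (c : k)
      rw [map_one, mul_one]
      exact ε.commutes c⟩
  | n + 1 => by
    rintro ⟨_, ⟨x, hx, rfl⟩⟩
    exact ⟨⟨x, hx⟩, rfl⟩

lemma toSyz_eq_zero_iff : ∀ n (x : (F.J n).baseChange A),
    F.toSyz n x = 0 ↔ (x : A ⊗[k] TensorAlgebra k V) ∈ F.boundaries n
  | 0, ⟨x, hx⟩ => by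
    constructor
    · exact F.exact_zero x hx
    · intro h
      -- That the augmentation kills boundaries is not a field of `FreeResolution`; it follows from
      -- `d_mem`.
      exact map_positivePart_eq_zero ε (F.toSyz 0) ⟨x, hx⟩ (F.boundaries_le_positivePart 0 h)
  | n + 1, ⟨x, hx⟩ => by
    refine Subtype.ext_iff.trans ⟨F.exact_succ n x hx, ?_⟩
    rintro ⟨y, hy, rfl⟩
    exact F.d_d' n hy

/-- The resolution as a chain of short exact sequences. -/
noncomputable def chain : SyzygyChain (ModuleCat.{u} A) where
  Z := F.syz
  X n := ModuleCat.of A ((F.J n).baseChange A)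
  i n := ModuleCat.ofHom (Submodule.inclusion (F.boundaries_le n))
  π n := ModuleCat.ofHom (F.toSyz n)
  zero n := by
    ext x
    exact (F.toSyz_eq_zero_iff n _).2 x.2
  shortExact n := ModuleCat.shortComplex_shortExact _
    (fun x => (F.toSyz_eq_zero_iff n x).trans
      ⟨fun h => ⟨⟨_, h⟩, rfl⟩, by rintro ⟨y, rfl⟩; exact y.2⟩)
    (Submodule.inclusion_injective (F.boundaries_le n)) (F.toSyz_surjective n)
  projective n := (IsProjective.iff_projective _).1 (projective_baseChange (F.J n))

lemma chain_isMinimalFor : F.chain.IsMinimalFor (trivialModule ε) := by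
  intro n f
  ext x
  exact map_positivePart_eq_zero ε f.hom _ (F.boundaries_le_positivePart n x.2)

/-- The functional on the generators of degree `n` defined by an element of `Ext^n(k, k)`. -/
noncomputable def coeff {n : ℕ} (α : SelfExt (trivialModule ε) n) (x : F.J n) : k :=
  (SyzygyChain.extEquiv F.chain_isMinimalFor n α).hom
    ⟨1 ⊗ₜ x, Submodule.tmul_mem_baseChange_of_mem 1 x.2⟩

lemma coeff_injective {n : ℕ} {α β : SelfExt (trivialModule ε) n}
    (h : ∀ x, F.coeff α x = F.coeff β x) : α = β := by
  refine (SyzygyChain.extEquiv F.chain_isMinimalFor n).injective (ModuleCat.hom_ext ?_)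
  exact baseChange_hom_ext fun x hx => h ⟨x, hx⟩

lemma exists_coeff_eq {n : ℕ} (lam : TensorAlgebra k V →ₗ[k] k) :
    ∃ α : SelfExt (trivialModule ε) n, ∀ x, F.coeff α x = lam x := by
  let f : F.chain.X n ⟶ trivialModule ε :=
    ModuleCat.ofHom (Y := trivialModule ε) (functional ε lam ∘ₗ Submodule.subtype _)
  refine ⟨(SyzygyChain.extEquiv F.chain_isMinimalFor n).symm f, fun x => ?_⟩
  have h : SyzygyChain.extEquiv F.chain_isMinimalFor n
    ((SyzygyChain.extEquiv F.chain_isMinimalFor n).symm f) = f := Equiv.apply_symm_apply _ _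
  refine (congrArg (fun g : F.chain.X n ⟶ trivialModule ε => (g.hom
    ⟨1 ⊗ₜ x, Submodule.tmul_mem_baseChange_of_mem 1 x.2⟩ : k)) h).trans ?_
  change ε 1 * lam x = lam x
  rw [map_one, one_mul]

/-- The functional on `J n` is extended to all of `T(V)`, so that classes over different algebras
can be compared through functionals on one common space. -/
lemma exists_eq_coeff {n : ℕ} (α : SelfExt (trivialModule ε) n) :
    ∃ lam : TensorAlgebra k V →ₗ[k] k, ∀ x, F.coeff α x = lam x := by
  let g : (F.J n).baseChange A →ₗ[A] trivialModule ε :=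
    (SyzygyChain.extEquiv F.chain_isMinimalFor n α).hom
  let f : F.J n →ₗ[k] k :=
    { toFun := F.coeff α
      map_add' x y := by
        refine Eq.trans (congrArg g (Subtype.ext ?_)) (map_add g _ _)
        exact TensorProduct.tmul_add _ _ _
      map_smul' c x := by
        have h := map_smul g (algebraMap k A c)
          ⟨1 ⊗ₜ x, Submodule.tmul_mem_baseChange_of_mem 1 x.2⟩
        refine (Eq.trans (congrArg g (Subtype.ext ?_)) h).trans
          (congrArg (· * F.coeff α x) (ε.commutes c))
        change (1 : A) ⊗ₜ[k] (c • (x : TensorAlgebra k V)) = algebraMap k A c • (1 ⊗ₜ[k] _)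
        rw [TensorProduct.smul_tmul', TensorProduct.tmul_smul, TensorProduct.smul_tmul',
          Algebra.smul_def, smul_eq_mul] }
  obtain ⟨g, hg⟩ := LinearMap.exists_extend f
  exact ⟨g, fun x => (LinearMap.congr_fun hg x).symm⟩

/-- The semilinear map `φ ⊗ id`. -/
noncomputable def _root_.MultiKoszul.semiMap {B : Type u} [Ring B] [Algebra k B] (φ : A →ₐ[k] B) :
    A ⊗[k] TensorAlgebra k V →ₛₗ[φ.toRingHom] B ⊗[k] TensorAlgebra k V where
  toFun := LinearMap.rTensor _ φ.toLinearMap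
  map_add' := map_add _
  map_smul' a x := by
    induction x with
    | zero => simp
    | tmul b t => simp [TensorProduct.smul_tmul']
    | add x y hx hy => rw [smul_add, map_add, hx, hy, map_add, smul_add]

lemma _root_.MultiKoszul.semiMap_tmul {B : Type u} [Ring B] [Algebra k B] (φ : A →ₐ[k] B)
    (a : A) (t : TensorAlgebra k V) : semiMap φ (a ⊗ₜ[k] t) = φ a ⊗ₜ t := rfl

lemma _root_.MultiKoszul.functional_semiMap {B : Type u} [Ring B] [Algebra k B]
    {ε' : B →ₐ[k] k} {φ : A →ₐ[k] B} (hφ : ε'.comp φ = ε) (lam : TensorAlgebra k V →ₗ[k] k)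
    (x : A ⊗[k] TensorAlgebra k V) :
    (functional ε' lam (semiMap φ x) : k) = functional ε lam x := by
  subst hφ
  induction x with
  | zero => simp only [map_zero]; rfl
  | tmul a t => rfl
  | add x y hx hy =>
    simp only [map_add]
    exact congrArg₂ (fun a b : k => a + b) hx hy

section Map
variable {B : Type u} [Ring B] [Algebra k B] {ε' : B →ₐ[k] k} {F} {G : FreeResolution V ε'}
  {φ : A →ₐ[k] B} (hφ : ε'.comp φ = ε) (hJ : ∀ n, F.J n ≤ G.J n)
  (hd : ∀ n, ∀ x ∈ F.J (n + 1), semiMap φ (F.d n (1 ⊗ₜ x)) = G.d n (1 ⊗ₜ x))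

include hJ in
lemma semiMap_mem (n : ℕ) {x : A ⊗[k] TensorAlgebra k V} (hx : x ∈ (F.J n).baseChange A) :
    semiMap φ x ∈ (G.J n).baseChange B := by
  have h : (F.J n).baseChange A ≤ ((G.J n).baseChange B).comap (semiMap φ) :=
    baseChange_le fun x hx => Submodule.tmul_mem_baseChange_of_mem _ (hJ n hx)
  exact h hx

include hd in
lemma semiMap_d (n : ℕ) {x : A ⊗[k] TensorAlgebra k V} (hx : x ∈ (F.J (n + 1)).baseChange A) :
    semiMap φ (F.d n x) = G.d n (semiMap φ x) := by
  refine baseChange_induction (motive := fun x => semiMap φ (F.d n x) = G.d n (semiMap φ x))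
    (by simp only [map_zero]) (fun a x hx => ?_) (fun x y hx hy => ?_) hx
  · have h : (a ⊗ₜ x : A ⊗[k] TensorAlgebra k V) = a • (1 ⊗ₜ x) := by
      rw [TensorProduct.smul_tmul', smul_eq_mul, mul_one]
    rw [h, map_smul, map_smulₛₗ, hd n x hx, map_smulₛₗ, map_smul, semiMap_tmul, map_one]
  · simp only [map_add, hx, hy]

/-- The comparison map on the terms of the resolutions. -/
noncomputable def compX (n : ℕ) :
    F.chain.X n ⟶ (ModuleCat.restrictScalars φ.toRingHom).obj (G.chain.X n) :=
  ModuleCat.semilinearMapAddEquiv φ.toRingHom (F.chain.X n) (G.chain.X n)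
    ((semiMap φ).restrict (p := (F.J n).baseChange A) (q := (G.J n).baseChange B)
      fun _ hx => semiMap_mem hJ n hx)

include hJ hd in
lemma semiMap_mem_boundaries (n : ℕ) {x : A ⊗[k] TensorAlgebra k V} (hx : x ∈ F.boundaries n) :
    semiMap φ x ∈ G.boundaries n := by
  obtain ⟨y, hy, rfl⟩ := hx
  exact ⟨_, semiMap_mem hJ _ hy, (semiMap_d hd n hy).symm⟩

/-- The comparison map on the syzygies. -/
noncomputable def compZ :
    ∀ n, F.chain.Z n ⟶ (ModuleCat.restrictScalars φ.toRingHom).obj (G.chain.Z n)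
  | 0 => (trivialModuleIso φ hφ).inv
  | n + 1 => ModuleCat.semilinearMapAddEquiv φ.toRingHom (F.chain.Z (n + 1)) (G.chain.Z (n + 1))
    ((semiMap φ).restrict (p := F.boundaries n) (q := G.boundaries n)
      fun _ hx => semiMap_mem_boundaries hJ hd n hx)

-- The comparison map `φ ⊗ id` fixes the generators `1 ⊗ x`, so by `extEquiv_map` the induced map on
-- `Ext` only restricts functionals.
include hd in
lemma coeff_map {n : ℕ} (α : SelfExt (trivialModule ε') n) (x : F.J n) :
    F.coeff (SelfExt.map (k := k) (ModuleCat.restrictScalars φ.toRingHom)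
      (trivialModuleIso φ hφ) n α) x = G.coeff α ⟨x, hJ n x.2⟩ := by
  have h := SyzygyChain.extEquiv_map (k := k) (K := G.chain) (L := F.chain)
    (ModuleCat.restrictScalars φ.toRingHom)
    (trivialModuleIso φ hφ) G.chain_isMinimalFor F.chain_isMinimalFor (compX hJ) (compZ hφ hJ hd)
    rfl (fun n => rfl) (fun n => ?_) α
  · refine (congrArg (fun f : F.chain.X n ⟶ trivialModule ε => (f.hom
      ⟨1 ⊗ₜ x, Submodule.tmul_mem_baseChange_of_mem 1 x.2⟩ : k)) h).trans ?_
    refine congrArg (SyzygyChain.extEquiv G.chain_isMinimalFor n α).hom (Subtype.ext ?_)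
    change φ 1 ⊗ₜ[k] _ = 1 ⊗ₜ[k] _
    rw [map_one]
    rfl
  · match n with
    | 0 =>
      ext x
      exact (functional_semiMap hφ _ _).symm
    | n + 1 =>
      ext x
      exact Subtype.ext (semiMap_d hd n x.2)

end Map

end FreeResolution
end FreeResolution

/-! ### Induction, splittings, grading and coordinates in `T(V)`. -/

section TensorAlgebraTools
universe v

variable {k : Type u} [Field k] {V : Type v} [AddCommGroup V] [Module k V]

lemma mul_mem_of_ι_mul_mem {N : Submodule k (TensorAlgebra k V)}
    (h : ∀ v, ∀ y ∈ N, TensorAlgebra.ι k v * y ∈ N) (x : TensorAlgebra k V) {y : TensorAlgebra k V}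
    (hy : y ∈ N) : x * y ∈ N := by
  induction x using TensorAlgebra.induction generalizing y with
  | algebraMap r => rw [← Algebra.smul_def]; exact N.smul_mem r hy
  | ι v => exact h v y hy
  | mul a b ha hb => rw [mul_assoc]; exact ha (hb hy)
  | add a b ha hb => rw [add_mul]; exact N.add_mem (ha hy) (hb hy)

lemma mul_mem_of_mul_ι_mem {N : Submodule k (TensorAlgebra k V)}
    (h : ∀ v, ∀ y ∈ N, y * TensorAlgebra.ι k v ∈ N) (x : TensorAlgebra k V) {y : TensorAlgebra k V}
    (hy : y ∈ N) : y * x ∈ N := by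
  induction x using TensorAlgebra.induction generalizing y with
  | algebraMap r => rw [← Algebra.commutes, ← Algebra.smul_def]; exact N.smul_mem r hy
  | ι v => exact h v y hy
  | mul a b ha hb => rw [← mul_assoc]; exact hb (ha hy)
  | add a b ha hb => rw [mul_add]; exact N.add_mem (ha hy) (hb hy)

lemma mem_of_one_mem_of_ι_mul_mem {N : Submodule k (TensorAlgebra k V)} (h1 : 1 ∈ N)
    (h : ∀ v y, TensorAlgebra.ι k v * y ∈ N) (x : TensorAlgebra k V) : x ∈ N := by
  simpa using mul_mem_of_ι_mul_mem (fun v y _ => h v y) x h1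

lemma mem_of_one_mem_of_mul_ι_mem {N : Submodule k (TensorAlgebra k V)} (h1 : 1 ∈ N)
    (h : ∀ v y, y * TensorAlgebra.ι k v ∈ N) (x : TensorAlgebra k V) : x ∈ N := by
  simpa using mul_mem_of_mul_ι_mem (fun v y _ => h v y) x h1

lemma relIdeal_induction {R N : Submodule k (TensorAlgebra k V)} (hR : R ≤ N)
    (hl : ∀ v, ∀ y ∈ N, TensorAlgebra.ι k v * y ∈ N)
    (hr : ∀ v, ∀ y ∈ N, y * TensorAlgebra.ι k v ∈ N) {x : TensorAlgebra k V}
    (hx : x ∈ relIdeal R) : x ∈ N := by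
  rw [TwoSidedIdeal.mem_asIdeal, TwoSidedIdeal.mem_span_iff_mem_addSubgroup_closure] at hx
  refine (AddSubgroup.closure_le N.toAddSubgroup).2 ?_ hx
  rintro _ ⟨_, ⟨a, -, r, hr', rfl⟩, b, -, rfl⟩
  exact mul_mem_of_mul_ι_mem hr b (mul_mem_of_ι_mul_mem hl a (hR hr'))

lemma ι_mem_tensorPow_one (v : V) : TensorAlgebra.ι k v ∈ tensorPow k V 1 := by
  rw [tensorPow, pow_one]
  exact ⟨v, rfl⟩

lemma exists_ι_of_mem_tensorPow_one {x : TensorAlgebra k V} (hx : x ∈ tensorPow k V 1) :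
    ∃ v, TensorAlgebra.ι k v = x := by
  rwa [tensorPow, pow_one] at hx

lemma tensorAug_ι_mul (v : V) (y : TensorAlgebra k V) :
    tensorAug (TensorAlgebra.ι k v * y) = (0 : k) := by
  simp [TensorAlgebra.algebraMapInv]

lemma tensorAug_mul_ι (v : V) (y : TensorAlgebra k V) :
    tensorAug (y * TensorAlgebra.ι k v) = (0 : k) := by
  simp [TensorAlgebra.algebraMapInv]

section Shift
variable {A : Type w} [Ring A] [Algebra k A] (p : TensorAlgebra k V →ₐ[k] A)

/-- The left action of `T(V)` on `k × (A ⊗ T(V))` in which `v ∈ V` sends `(c, y)` to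
`(0, p(v) y + c (1 ⊗ v))`. -/
noncomputable def splitLastAction : TensorAlgebra k V →ₐ[k]
    Module.End k (k × (A ⊗[k] TensorAlgebra k V)) :=
  TensorAlgebra.lift k
    { toFun v := LinearMap.prod 0
        (Algebra.lsmul k k _ (p (TensorAlgebra.ι k v)) ∘ₗ LinearMap.snd k _ _ +
          LinearMap.toSpanSingleton k _ (1 ⊗ₜ TensorAlgebra.ι k v) ∘ₗ LinearMap.fst k _ _)
      map_add' v v' := by
        ext x <;> simp [TensorProduct.tmul_add]
      map_smul' c v := by
        ext x <;> simp }

lemma splitLastAction_ι (v : V) (z : k × (A ⊗[k] TensorAlgebra k V)) :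
    splitLastAction p (TensorAlgebra.ι k v) z =
      (0, p (TensorAlgebra.ι k v) • z.2 + z.1 • (1 ⊗ₜ TensorAlgebra.ι k v)) := by
  simp [splitLastAction]

lemma splitLastAction_zero (x : TensorAlgebra k V) (y : A ⊗[k] TensorAlgebra k V) :
    splitLastAction p x (0, y) = (0, p x • y) := by
  induction x using TensorAlgebra.induction generalizing y with
  | algebraMap r => simp [Module.algebraMap_end_apply]
  | ι v => simp [splitLastAction_ι]
  | mul a b ha hb => rw [map_mul, Module.End.mul_apply, hb, ha, map_mul, mul_smul]
  | add a b ha hb => rw [map_add, LinearMap.add_apply, ha, hb, map_add, add_smul]; simp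

/-- The linear map `T(V) → A ⊗ T(V)` with `v₁ ⋯ vₙ ↦ p(v₁ ⋯ vₙ₋₁) ⊗ vₙ` for `n ≥ 1` and
`1 ↦ 0`. -/
noncomputable def splitLast : TensorAlgebra k V →ₗ[k] A ⊗[k] TensorAlgebra k V :=
  LinearMap.snd k _ _ ∘ₗ LinearMap.applyₗ (1, 0) ∘ₗ (splitLastAction p).toLinearMap

lemma splitLast_one : splitLast p 1 = 0 := by
  simp [splitLast]

lemma splitLast_mul_ι (x : TensorAlgebra k V) (v : V) :
    splitLast p (x * TensorAlgebra.ι k v) = p x ⊗ₜ TensorAlgebra.ι k v := by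
  change (splitLastAction p (x * TensorAlgebra.ι k v) (1, 0)).2 = _
  rw [map_mul, Module.End.mul_apply, splitLastAction_ι, smul_zero, zero_add, one_smul,
    splitLastAction_zero, TensorProduct.smul_tmul', smul_eq_mul, mul_one]

lemma splitLastAction_fst (x : TensorAlgebra k V) (z : k × (A ⊗[k] TensorAlgebra k V)) :
    (splitLastAction p x z).1 = tensorAug x * z.1 := by
  induction x using TensorAlgebra.induction generalizing z with
  | algebraMap r => simp [Module.algebraMap_end_apply]
  | ι v => simp [splitLastAction_ι, TensorAlgebra.algebraMapInv]
  | mul a b ha hb => rw [map_mul, Module.End.mul_apply, ha, hb, map_mul, mul_assoc]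
  | add a b ha hb => rw [map_add, LinearMap.add_apply, Prod.fst_add, ha, hb, map_add, add_mul]

/-- The augmentation hypothesis excludes constants: `v * 1` is split as `1 ⊗ v`, whereas `splitLast
p 1 = 0`. -/
lemma splitLast_ι_mul (v : V) {x : TensorAlgebra k V} (hx : tensorAug x = (0 : k)) :
    splitLast p (TensorAlgebra.ι k v * x) = p (TensorAlgebra.ι k v) • splitLast p x := by
  change (splitLastAction p (TensorAlgebra.ι k v * x) (1, 0)).2 = _
  rw [map_mul, Module.End.mul_apply, ← Prod.mk.eta (p := splitLastAction p x (1, 0)),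
    splitLastAction_fst, hx, zero_mul, splitLastAction_zero]
  rfl

lemma splitLast_mem (x : TensorAlgebra k V) :
    splitLast p x ∈ (tensorPow k V 1).baseChange A := by
  have h := mem_of_one_mem_of_mul_ι_mem
    (N := (((tensorPow k V 1).baseChange A).restrictScalars k).comap (splitLast p))
    (by rw [Submodule.mem_comap, splitLast_one]; exact Submodule.zero_mem _)
    (fun v y => by
      rw [Submodule.mem_comap, splitLast_mul_ι]
      exact Submodule.tmul_mem_baseChange_of_mem _ (ι_mem_tensorPow_one v)) x
  exact h

lemma shift_tmul_ι (a : A) (v : V) :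
    shift p (a ⊗ₜ TensorAlgebra.ι k v) = (a * p (TensorAlgebra.ι k v)) ⊗ₜ 1 := by
  rw [← mul_one (TensorAlgebra.ι k v), shift_tmul_ι_mul, mul_one]

/-- Split off the last letter `v` and multiply it back: `p x ⊗ v` goes to `p (x v) ⊗ 1`. Thus
`splitLast` is a preimage under `δ_1` on the augmentation ideal. -/
lemma shift_splitLast (x : TensorAlgebra k V) (hx : tensorAug x = (0 : k)) :
    shift p (splitLast p x) = p x ⊗ₜ 1 := by
  let N : Submodule k (TensorAlgebra k V) := LinearMap.eqLocus
    ((shift p).restrictScalars k ∘ₗ splitLast p)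
    ((TensorProduct.mk k A (TensorAlgebra k V)).flip 1 ∘ₗ
      (p.toLinearMap - Algebra.linearMap k A ∘ₗ tensorAug.toLinearMap))
  have h : x ∈ N := mem_of_one_mem_of_mul_ι_mem
    (by simp [N, splitLast_one])
    (fun v y => by
      rw [LinearMap.mem_eqLocus]
      simp [splitLast_mul_ι, shift_tmul_ι, tensorAug_mul_ι]) x
  rw [LinearMap.mem_eqLocus] at h
  simpa [hx] using h

lemma shift_pow_tmul_mul {c : ℕ} (a : A) {y : TensorAlgebra k V} (hy : y ∈ tensorPow k V c)
    (z : TensorAlgebra k V) : (shift p ^ c) (a ⊗ₜ (y * z)) = (a * p y) ⊗ₜ z := by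
  induction c generalizing a y with
  | zero =>
    rw [tensorPow, pow_zero, Submodule.mem_one] at hy
    obtain ⟨r, rfl⟩ := hy
    rw [pow_zero, Module.End.one_apply, ← Algebra.smul_def, AlgHom.commutes, ← Algebra.commutes,
      ← Algebra.smul_def, TensorProduct.smul_tmul]
  | succ c ih =>
    rw [tensorPow, pow_succ'] at hy
    induction hy using Submodule.mul_induction_on' with
    | mem_mul_mem m hm n hn =>
      obtain ⟨v, rfl⟩ := hm
      rw [pow_succ, Module.End.mul_apply, mul_assoc, shift_tmul_ι_mul, ih _ hn, map_mul, mul_assoc]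
    | add x hx y hy ihx ihy =>
      rw [add_mul, TensorProduct.tmul_add, map_add, ihx, ihy, map_add, mul_add,
        TensorProduct.add_tmul]

/-- Maps of algebras are compatible with the shift. -/
lemma map_shift {B : Type*} [Ring B] [Algebra k B] (π : A →ₐ[k] B)
    (x : A ⊗[k] TensorAlgebra k V) :
    π.toLinearMap.rTensor _ (shift p x) =
      shift (π.comp p) (π.toLinearMap.rTensor _ x) := by
  induction x with
  | zero => simp
  | add x y hx hy => simp only [map_add, hx, hy]
  | tmul a t =>
    let N : Submodule k (TensorAlgebra k V) := LinearMap.eqLocus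
      (π.toLinearMap.rTensor _ ∘ₗ (shift p).restrictScalars k ∘ₗ TensorProduct.mk k A _ a)
      ((shift (π.comp p)).restrictScalars k ∘ₗ π.toLinearMap.rTensor _ ∘ₗ
        TensorProduct.mk k A _ a)
    have h : t ∈ N := mem_of_one_mem_of_ι_mul_mem
      (by simp [N, shift_tmul_one]) (fun v y => by simp [N, shift_tmul_ι_mul]) t
    exact h

end Shift

section Grading

/-- The projection of `T(V)` onto `V^{⊗ n}`. -/
noncomputable abbrev projT (n : ℕ) : TensorAlgebra k V →ₗ[k] TensorAlgebra k V :=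
  GradedAlgebra.proj (tensorPow k V) n

lemma projT_mem (n : ℕ) (x : TensorAlgebra k V) : projT n x ∈ tensorPow k V n :=
  SetLike.coe_mem _

lemma projT_of_mem {n : ℕ} {x : TensorAlgebra k V} (hx : x ∈ tensorPow k V n) : projT n x = x :=
  DirectSum.decompose_of_mem_same _ hx

lemma projT_of_mem_ne {m n : ℕ} {x : TensorAlgebra k V} (hx : x ∈ tensorPow k V m) (h : m ≠ n) :
    projT n x = 0 :=
  DirectSum.decompose_of_mem_ne _ hx h

lemma projT_mul_left {m : ℕ} {y : TensorAlgebra k V} (hy : y ∈ tensorPow k V m) (n : ℕ)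
    (z : TensorAlgebra k V) : projT (m + n) (y * z) = y * projT n z :=
  DirectSum.coe_decompose_mul_add_of_left_mem _ hy

lemma projT_mul_left_of_lt {m n : ℕ} {y : TensorAlgebra k V} (hy : y ∈ tensorPow k V m)
    (h : n < m) (z : TensorAlgebra k V) : projT n (y * z) = 0 :=
  DirectSum.coe_decompose_mul_of_left_mem_of_not_le _ hy h.not_ge

lemma projT_mul_right {m : ℕ} {y : TensorAlgebra k V} (hy : y ∈ tensorPow k V m) (n : ℕ)
    (z : TensorAlgebra k V) : projT (n + m) (z * y) = projT n z * y :=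
  DirectSum.coe_decompose_mul_add_of_right_mem _ hy

lemma projT_mul_right_of_lt {m n : ℕ} {y : TensorAlgebra k V} (hy : y ∈ tensorPow k V m)
    (h : n < m) (z : TensorAlgebra k V) : projT n (z * y) = 0 :=
  DirectSum.coe_decompose_mul_of_right_mem_of_not_le _ hy h.not_ge

lemma exists_sum_projT (x : TensorAlgebra k V) :
    ∃ N, ∀ M, N ≤ M → ∑ n ∈ Finset.range M, projT n x = x := by
  classical
  refine ⟨((DirectSum.decompose (tensorPow k V) x).support.sup id) + 1, fun M hM => ?_⟩
  conv_rhs => rw [← DirectSum.sum_support_decompose (tensorPow k V) x]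
  symm
  refine Finset.sum_subset (fun i hi => ?_) (fun i _ hi => ?_)
  · have := Finset.le_sup (f := id) hi
    rw [Finset.mem_range]
    simp only [id] at this
    lia
  · rw [DFinsupp.notMem_support_iff.1 hi]
    rfl

/-- Multiplication by a vector shifts degrees, so the induction over the ideal treats all
homogeneous components at once. -/
lemma projT_mem_relIdeal {R : Submodule k (TensorAlgebra k V)}
    (hR : ∀ x ∈ R, ∀ n, projT n x ∈ R) {x : TensorAlgebra k V} (hx : x ∈ relIdeal R) (n : ℕ) :
    projT n x ∈ relIdeal R := by
  let N : Submodule k (TensorAlgebra k V) :=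
    ⨅ n, ((relIdeal R).restrictScalars k).comap (projT n)
  have hN : ∀ x, x ∈ N ↔ ∀ n, projT n x ∈ relIdeal R := fun x => by
    simp only [N, Submodule.mem_iInf]
    rfl
  refine (hN x).1 (relIdeal_induction (fun x hx => ?_) (fun v y hy => ?_) (fun v y hy => ?_) hx) n
  · exact (hN x).2 fun n => TwoSidedIdeal.subset_span (hR x hx n)
  · refine (hN _).2 fun n => ?_
    match n with
    | 0 => rw [projT_mul_left_of_lt (ι_mem_tensorPow_one v) one_pos]; exact zero_mem _
    | n + 1 =>
      rw [add_comm, projT_mul_left (ι_mem_tensorPow_one v)]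
      exact Ideal.mul_mem_left _ _ ((hN y).1 hy n)
  · refine (hN _).2 fun n => ?_
    match n with
    | 0 => rw [projT_mul_right_of_lt (ι_mem_tensorPow_one v) one_pos]; exact zero_mem _
    | n + 1 =>
      rw [projT_mul_right (ι_mem_tensorPow_one v)]
      exact TwoSidedIdeal.mul_mem_right _ _ _ ((hN y).1 hy n)

end Grading

section Coordinates
variable [FiniteDimensional k V]

/-- The linear maps `T(V) → T(V)` with `x = ∑ i, e i * x i` on the augmentation ideal, where `e` is
a basis of `V`. -/
noncomputable def firstCoord (i : Fin (Module.finrank k V)) :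
    TensorAlgebra k V →ₗ[k] TensorAlgebra k V :=
  (TensorProduct.lid k _).toLinearMap ∘ₗ
    LinearMap.rTensor _ ((Module.finBasis k V).coord i ∘ₗ TensorAlgebra.ιInv) ∘ₗ
    splitFirst (AlgHom.id k _)

lemma firstCoord_ι_mul (i : Fin (Module.finrank k V)) (v : V) (x : TensorAlgebra k V) :
    firstCoord i (TensorAlgebra.ι k v * x) = (Module.finBasis k V).coord i v • x := by
  simp [firstCoord, splitFirst_ι_mul, TensorAlgebra.ι_leftInverse v]

lemma firstCoord_mem {X : Submodule k (TensorAlgebra k V)} {x : TensorAlgebra k V}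
    (hx : x ∈ LinearMap.range (TensorAlgebra.ι k : V →ₗ[k] _) * X) (i : Fin (Module.finrank k V)) :
    firstCoord i x ∈ X := by
  induction hx using Submodule.mul_induction_on' with
  | mem_mul_mem m hm n hn =>
    obtain ⟨v, rfl⟩ := hm
    rw [firstCoord_ι_mul]
    exact X.smul_mem _ hn
  | add x hx y hy ihx ihy => rw [map_add]; exact X.add_mem ihx ihy

lemma sum_ι_mul_firstCoord {X : Submodule k (TensorAlgebra k V)} {x : TensorAlgebra k V}
    (hx : x ∈ LinearMap.range (TensorAlgebra.ι k : V →ₗ[k] _) * X) :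
    ∑ i, TensorAlgebra.ι k (Module.finBasis k V i) * firstCoord i x = x := by
  induction hx using Submodule.mul_induction_on' with
  | mem_mul_mem m hm n hn =>
    obtain ⟨v, rfl⟩ := hm
    simp only [firstCoord_ι_mul, mul_smul_comm, ← smul_mul_assoc]
    rw [← Finset.sum_mul]
    congr 1
    simp only [← map_smul]
    rw [← map_sum]
    exact congrArg _ ((Module.finBasis k V).sum_repr v)
  | add x hx y hy ihx ihy =>
    simp only [map_add, mul_add, Finset.sum_add_distrib]
    rw [ihx, ihy]

/-- An element of `V ⊗ X` is determined by its coordinates along a basis of `V`, and it lies in `V ⊗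
X` for each `X j` only if all its coordinates lie in each `X j`. Iterating over `c` letters gives
the claim. An index is needed because the expansion in coordinates holds only for elements without
constant term. -/
lemma iInf_tensorPow_mul_le {κ : Type*} [Nonempty κ] (c : ℕ)
    (X : κ → Submodule k (TensorAlgebra k V)) :
    ⨅ j, tensorPow k V c * X j ≤ tensorPow k V c * ⨅ j, X j := by
  induction c with
  | zero => simp
  | succ c ih =>
    simp only [tensorPow, pow_succ', mul_assoc] at ih ⊢
    intro x hx
    rw [Submodule.mem_iInf] at hx
    obtain ⟨j₀⟩ := ‹Nonempty κ›
    rw [← sum_ι_mul_firstCoord (hx j₀)]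
    refine Submodule.sum_mem _ fun i _ => Submodule.mul_mem_mul ⟨_, rfl⟩ (ih ?_)
    exact (Submodule.mem_iInf _).2 fun j => firstCoord_mem (hx j) i

end Coordinates

end TensorAlgebraTools

/-! ### The Koszul complex of an `s`-homogeneous algebra and its exactness in low degrees. -/

section KoszulComplex

variable {k : Type u} [Field k] {V : Type u} [AddCommGroup V] [Module k V]

/-- The degree of the differential `K_{n+1} → K_n` of the Koszul complex of an `s`-homogeneous
algebra. -/
def step (s n : ℕ) : ℕ := if Even (n + 1) then s - 1 else 1

lemma step_pos {s : ℕ} (hs : 2 ≤ s) (n : ℕ) : 0 < step s n := by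
  unfold step
  split_ifs <;> lia

lemma step_add_step {s : ℕ} (hs : 2 ≤ s) (n : ℕ) : step s n + step s (n + 1) = s := by
  unfold step
  by_cases h : Even n
  · rw [if_neg (by grind), if_pos (by grind)]; lia
  · rw [if_pos (by grind), if_neg (by grind)]; lia

lemma deg_succ {s : ℕ} (hs : 2 ≤ s) (n : ℕ) :
    Presentation.deg s (n + 1) = Presentation.deg s n + step s n := by
  unfold Presentation.deg step
  obtain ⟨l, rfl | rfl⟩ := n.even_or_odd'
  · rw [if_neg (by grind)]
    have h₁ : (2 * l + 1) / 2 = l := by lia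
    have h₂ : 2 * l / 2 = l := by lia
    rw [h₁, h₂]
    lia
  · rw [if_pos (by grind)]
    have h₁ : (2 * l + 1 + 1) / 2 = l + 1 := by lia
    have h₂ : (2 * l + 1) / 2 = l := by lia
    rw [h₁, h₂, mul_add]
    lia

lemma le_deg {s : ℕ} (hs : 2 ≤ s) (n : ℕ) : s ≤ Presentation.deg s (n + 2) := by
  rw [deg_succ hs, deg_succ hs]
  have := step_add_step hs n
  lia

/-- The shift by `2` matters: `deg s 0` and `deg s 1` do not depend on `s`. -/
lemma deg_injective {s t : ℕ} (n : ℕ)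
    (h : Presentation.deg s (n + 2) = Presentation.deg t (n + 2)) :
    s = t := by
  unfold Presentation.deg at h
  have h' : s * ((n + 2) / 2) = t * ((n + 2) / 2) := by lia
  exact Nat.eq_of_mul_eq_mul_right (by lia) h'

/-- The spaces `k`, `V`, `R`, `(R ⊗ V) ∩ (V ⊗ R)`, ... of generators of the Koszul complex of the
algebra with space of relations `R ⊆ V^{⊗ s}`. -/
noncomputable def koszulSpace (R : Submodule k (TensorAlgebra k V)) (s : ℕ) :
    ℕ → Submodule k (TensorAlgebra k V)
  | 0 => tensorPow k V 0
  | 1 => tensorPow k V 1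
  | i + 2 => ⨅ j ∈ Finset.range (Presentation.deg s (i + 2) - s + 1),
      tensorPow k V j * R * tensorPow k V (Presentation.deg s (i + 2) - s - j)

lemma Presentation.JS_eq (P : Presentation k V) (s : ℕ) : ∀ n, P.JS s n = koszulSpace (P.R s) s n
  | 0 => rfl
  | 1 => rfl
  | _ + 2 => rfl

variable {R : Submodule k (TensorAlgebra k V)} {s : ℕ}

lemma koszulSpace_two : koszulSpace R s 2 = R := by
  simp [koszulSpace, Presentation.deg]

lemma koszulSpace_add_two_le_mul (n : ℕ) : koszulSpace R s (n + 2) ≤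
    R * tensorPow k V (Presentation.deg s (n + 2) - s) := by
  refine (iInf₂_le 0 (by simp)).trans ?_
  simp

lemma koszulSpace_le (hs : 2 ≤ s) (hR : R ≤ tensorPow k V s) :
    ∀ n, koszulSpace R s n ≤ tensorPow k V (Presentation.deg s n)
  | 0 => by simp [koszulSpace, Presentation.deg]
  | 1 => by simp [koszulSpace, Presentation.deg]
  | n + 2 => by
    refine (koszulSpace_add_two_le_mul n).trans ((mul_le_mul' hR le_rfl).trans ?_)
    rw [tensorPow, tensorPow, ← pow_add, Nat.add_sub_cancel' (le_deg hs n)]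

/-- Of the conditions defining the intersection, those in which `R` sits at position `step s n` or
later all have a left factor `V^{⊗ step s n}`; this factor is pulled out of the intersection. -/
lemma koszulSpace_succ_le [FiniteDimensional k V] (hs : 2 ≤ s) (hR : R ≤ tensorPow k V s) :
    ∀ n, koszulSpace R s (n + 1) ≤ tensorPow k V (step s n) * koszulSpace R s n
  | 0 => by simp [koszulSpace, step]
  | 1 => by
    rw [koszulSpace_two]
    change R ≤ tensorPow k V _ * tensorPow k V 1
    have h : step s 1 + 1 = s := by rw [step, if_pos (by decide)]; lia
    rwa [tensorPow, tensorPow, ← pow_add, h]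
  | n + 2 => by
    have h := deg_succ hs (n + 2)
    have h' := le_deg hs n
    simp only [koszulSpace]
    conv_rhs => rw [iInf_subtype']
    have : Nonempty {j // j ∈ Finset.range (Presentation.deg s (n + 2) - s + 1)} :=
      ⟨⟨0, by simp⟩⟩
    refine le_trans (le_iInf ?_) (iInf_tensorPow_mul_le _ _)
    rintro ⟨j, hj⟩
    refine (iInf₂_le (step s (n + 2) + j) ?_).trans (le_of_eq ?_)
    · rw [Finset.mem_range] at hj ⊢
      lia
    · rw [tensorPow, pow_add, mul_assoc, mul_assoc, mul_assoc]
      congr 4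
      lia

section Algebra
variable {A : Type u} [Ring A] [Algebra k A] (p : TensorAlgebra k V →ₐ[k] A)

lemma shift_pow_mem_baseChange {J : Submodule k (TensorAlgebra k V)} {c : ℕ} {x}
    (hx : x ∈ (tensorPow k V c * J).baseChange A) : (shift p ^ c) x ∈ J.baseChange A := by
  have h : (tensorPow k V c * J).baseChange A ≤ (J.baseChange A).comap (shift p ^ c) := by
    refine baseChange_le fun y hy => ?_
    rw [Submodule.mem_comap]
    induction hy using Submodule.mul_induction_on' with
    | mem_mul_mem m hm n hn =>
      rw [shift_pow_tmul_mul p 1 hm]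
      exact Submodule.tmul_mem_baseChange_of_mem _ hn
    | add y _ z _ hy hz =>
      rw [TensorProduct.tmul_add, map_add]
      exact add_mem hy hz
  exact h hx

lemma shift_pow_mem [FiniteDimensional k V] (hs : 2 ≤ s) (hR : R ≤ tensorPow k V s) (n : ℕ) {x}
    (hx : x ∈ (koszulSpace R s (n + 1)).baseChange A) :
    (shift p ^ step s n) x ∈ (koszulSpace R s n).baseChange A :=
  shift_pow_mem_baseChange p (Submodule.baseChange_mono A (koszulSpace_succ_le hs hR n) hx)

variable {p}

lemma shift_pow_eq_zero (hR : R ≤ tensorPow k V s) (hp : ∀ x ∈ R, p x = 0)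
    {N : Submodule k (TensorAlgebra k V)} {x} (hx : x ∈ (R * N).baseChange A) :
    (shift p ^ s) x = 0 := by
  have h : (R * N).baseChange A ≤ LinearMap.ker (shift p ^ s) := by
    refine baseChange_le fun y hy => ?_
    rw [LinearMap.mem_ker]
    induction hy using Submodule.mul_induction_on' with
    | mem_mul_mem m hm n hn =>
      rw [shift_pow_tmul_mul p 1 (hR hm), hp m hm, mul_zero, TensorProduct.zero_tmul]
    | add y _ z _ hy hz => rw [TensorProduct.tmul_add, map_add, hy, hz, add_zero]
  exact h hx

/-- Two consecutive differentials move exactly `s` letters into `A`, and the first `s` letters form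
a relation. -/
lemma shift_pow_shift_pow_eq_zero (hs : 2 ≤ s) (hR : R ≤ tensorPow k V s) (hp : ∀ x ∈ R, p x = 0)
    (n : ℕ) {x} (hx : x ∈ (koszulSpace R s (n + 2)).baseChange A) :
    (shift p ^ step s n) ((shift p ^ step s (n + 1)) x) = 0 := by
  rw [← Module.End.mul_apply, ← pow_add, step_add_step hs]
  exact shift_pow_eq_zero hR hp (Submodule.baseChange_mono A (koszulSpace_add_two_le_mul n) hx)

/-- Induction over the ideal: a relation `r` splits as `δ_2 (1 ⊗ r)`, left multiplication commutes
with splitting on the augmentation ideal, and right multiplication by `v` gives `p y ⊗ v = 0`. -/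
lemma splitLast_mem_map (hs : 2 ≤ s) (hR : R ≤ tensorPow k V s) (hp : ∀ x ∈ R, p x = 0)
    {m : TensorAlgebra k V} (hm : m ∈ relIdeal R) :
    splitLast p m ∈ (R.baseChange A).map (shift p ^ (s - 1)) := by
  let M := ((R.baseChange A).map (shift p ^ (s - 1))).restrictScalars k
  -- Vanishing augmentation is carried along for left multiplication, and `p x = 0` for right
  -- multiplication.
  let N : Submodule k (TensorAlgebra k V) := LinearMap.ker tensorAug.toLinearMap ⊓
    (LinearMap.ker p.toLinearMap ⊓ M.comap (splitLast p))
  have hN : ∀ x, x ∈ N ↔ tensorAug x = (0 : k) ∧ p x = 0 ∧ splitLast p x ∈ M := fun x => Iff.rfl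
  refine ((hN m).1 (relIdeal_induction (fun r hr => ?_) (fun v y hy => ?_) (fun v y hy => ?_)
    hm)).2.2
  · refine (hN r).2 ⟨tensorAug_eq_zero (by lia) r (hR hr), hp r hr, 1 ⊗ₜ r,
      Submodule.tmul_mem_baseChange_of_mem _ hr, ?_⟩
    have h : r ∈ tensorPow k V (s - 1) * LinearMap.range (TensorAlgebra.ι k) := by
      rw [tensorPow, ← pow_succ, Nat.sub_add_cancel (by lia)]
      exact hR hr
    clear hr
    induction h using Submodule.mul_induction_on' with
    | mem_mul_mem m hm n hn =>
      obtain ⟨v, rfl⟩ := hn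
      rw [shift_pow_tmul_mul p 1 hm, one_mul, splitLast_mul_ι]
    | add x hx y hy ihx ihy => rw [TensorProduct.tmul_add, map_add, ihx, ihy, map_add]
  · obtain ⟨h₁, h₂, h₃⟩ := (hN y).1 hy
    refine (hN _).2 ⟨tensorAug_ι_mul v y, by rw [map_mul, h₂, mul_zero], ?_⟩
    rw [splitLast_ι_mul p v h₁]
    exact ((R.baseChange A).map (shift p ^ (s - 1))).smul_mem _ h₃
  · obtain ⟨h₁, h₂, h₃⟩ := (hN y).1 hy
    refine (hN _).2 ⟨tensorAug_mul_ι v y, by rw [map_mul, h₂, zero_mul], ?_⟩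
    rw [splitLast_mul_ι, h₂, TensorProduct.zero_tmul]
    exact zero_mem _

lemma tmul_one_injective {a b : A} (h : a ⊗ₜ[k] (1 : TensorAlgebra k V) = b ⊗ₜ 1) : a = b := by
  have := congrArg (TensorProduct.rid k A ∘ LinearMap.lTensor A tensorAug.toLinearMap) h
  simpa using this

lemma exists_splitLast_eq (hp : Function.Surjective p) {x}
    (hx : x ∈ (tensorPow k V 1).baseChange A) :
    ∃ m, tensorAug m = (0 : k) ∧ splitLast p m = x := by
  refine baseChange_induction (motive := fun x => ∃ m, tensorAug m = (0 : k) ∧ splitLast p m = x)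
    ⟨0, by simp⟩ (fun a y hy => ?_) (fun x y hx hy => ?_) hx
  · obtain ⟨t, rfl⟩ := hp a
    obtain ⟨v, rfl⟩ := exists_ι_of_mem_tensorPow_one hy
    exact ⟨t * TensorAlgebra.ι k v, tensorAug_mul_ι v t, splitLast_mul_ι p t v⟩
  · obtain ⟨m, hm, rfl⟩ := hx
    obtain ⟨n, hn, rfl⟩ := hy
    exact ⟨m + n, by rw [map_add, hm, hn, add_zero], map_add _ _ _⟩

/-- A cycle in `A ⊗ V` is `splitLast p m` for some `m` with `p m = 0`, that is, with `m` in the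
ideal of relations. So exactness here only says that `R` generates all relations. -/
lemma exists_shift_pow_eq (hs : 2 ≤ s) (hR : R ≤ tensorPow k V s) (hsurj : Function.Surjective p)
    (hp : ∀ x, p x = 0 ↔ x ∈ relIdeal R) {x} (hx : x ∈ (tensorPow k V 1).baseChange A)
    (h : shift p x = 0) : ∃ y ∈ R.baseChange A, (shift p ^ (s - 1)) y = x := by
  obtain ⟨m, hm, rfl⟩ := exists_splitLast_eq hsurj hx
  rw [shift_splitLast p m hm, ← TensorProduct.zero_tmul] at h
  exact splitLast_mem_map hs hR (fun x hx => (hp x).2 (TwoSidedIdeal.subset_span hx))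
    ((hp m).1 (tmul_one_injective h))

variable {ε : A →ₐ[k] k}

lemma shift_pow_mem_positivePart (hε : ε.comp p = tensorAug)
    {J : Submodule k (TensorAlgebra k V)} {c : ℕ} (hc : c ≠ 0) {x} (hx : x ∈ tensorPow k V c * J) :
    (shift p ^ c) (1 ⊗ₜ x) ∈ positivePart ε J := by
  induction hx using Submodule.mul_induction_on' with
  | mem_mul_mem m hm n hn =>
    rw [shift_pow_tmul_mul p 1 hm, one_mul]
    refine Submodule.subset_span ⟨p m, ?_, n, hn, rfl⟩
    rw [← AlgHom.comp_apply, hε]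
    exact tensorAug_eq_zero hc m hm
  | add y _ z _ hy hz =>
    rw [TensorProduct.tmul_add, map_add]
    exact add_mem hy hz

lemma exists_shift_eq (hε : ε.comp p = tensorAug) (hsurj : Function.Surjective p) {x}
    (hx : x ∈ (tensorPow k V 0).baseChange A)
    (h : functional ε tensorAug.toLinearMap x = (0 : k)) :
    ∃ y ∈ (tensorPow k V 1).baseChange A, shift p y = x := by
  obtain ⟨m, rfl⟩ : ∃ m, p m ⊗ₜ 1 = x := by
    refine baseChange_induction (motive := fun x => ∃ m, p m ⊗ₜ 1 = x)
      ⟨0, by simp⟩ (fun a y hy => ?_) (fun x y hx hy => ?_) hx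
    · obtain ⟨t, rfl⟩ := hsurj a
      rw [tensorPow, pow_zero, Submodule.mem_one] at hy
      obtain ⟨r, rfl⟩ := hy
      refine ⟨r • t, ?_⟩
      rw [map_smul, TensorProduct.smul_tmul, Algebra.algebraMap_eq_smul_one]
    · obtain ⟨m, rfl⟩ := hx
      obtain ⟨n, rfl⟩ := hy
      exact ⟨m + n, by rw [map_add, TensorProduct.add_tmul]⟩
  have h' : ε (p m) * tensorAug (1 : TensorAlgebra k V) = (0 : k) := h
  rw [map_one, mul_one, ← AlgHom.comp_apply, hε] at h'
  exact ⟨splitLast p m, splitLast_mem p m, shift_splitLast p m h'⟩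

/-- The Koszul resolution of the trivial module of an `s`-Koszul algebra. -/
noncomputable def koszulResolution [FiniteDimensional k V] (hε : ε.comp p = tensorAug) (hs : 2 ≤ s)
    (hR : R ≤ tensorPow k V s) (hsurj : Function.Surjective p)
    (hp : ∀ x, p x = 0 ↔ x ∈ relIdeal R)
    (hexact : ∀ n, ∀ x ∈ (koszulSpace R s (n + 2)).baseChange A,
      (shift p ^ step s (n + 1)) x = 0 →
        ∃ y ∈ (koszulSpace R s (n + 3)).baseChange A, (shift p ^ step s (n + 2)) y = x) :
    FreeResolution V ε where
  J := koszulSpace R s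
  d n := shift p ^ step s n
  one_mem := by
    rw [koszulSpace, tensorPow, pow_zero]
    exact Submodule.one_le.1 le_rfl
  d_mem n x hx := shift_pow_mem_positivePart hε (step_pos hs n).ne' (koszulSpace_succ_le hs hR n hx)
  exact_zero x hx h := exists_shift_eq hε hsurj hx h
  d_d n x hx := shift_pow_shift_pow_eq_zero hs hR
    (fun y hy => (hp y).2 (TwoSidedIdeal.subset_span hy)) n
    (Submodule.tmul_mem_baseChange_of_mem 1 hx)
  exact_succ
    | 0, x, hx, h => by
      rw [koszulSpace_two]
      exact exists_shift_pow_eq hs hR hsurj hp hx h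
    | n + 1, x, hx, h => hexact n x hx h

end Algebra

end KoszulComplex

/-! ### Graded quotients of `T(V)` and minimal generators of the kernel between two of them. -/

section GradedQuotient

variable {k : Type u} [Field k] {V : Type u} [AddCommGroup V] [Module k V]
variable {A B : Type u} [Ring A] [Algebra k A] [Ring B] [Algebra k B]

/-- `p : T(V) → B` is surjective with homogeneous kernel. -/
structure IsGradedQuotient (p : TensorAlgebra k V →ₐ[k] B) : Prop where
  surjective : Function.Surjective p
  map_projT : ∀ x n, p x = 0 → p (projT n x) = 0

namespace IsGradedQuotient

variable {p : TensorAlgebra k V →ₐ[k] B} (hp : IsGradedQuotient p)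

/-- The projection of a graded quotient of `T(V)` onto its component of degree `n`. -/
noncomputable def proj (n : ℕ) : B →ₗ[k] B :=
  p.toLinearMap ∘ₗ projT n ∘ₗ (LinearMap.exists_rightInverse_of_surjective p.toLinearMap
    (LinearMap.range_eq_top.2 hp.surjective)).choose

lemma proj_apply (n : ℕ) (x : TensorAlgebra k V) : hp.proj n (p x) = p (projT n x) := by
  have h := (LinearMap.exists_rightInverse_of_surjective p.toLinearMap
    (LinearMap.range_eq_top.2 hp.surjective)).choose_spec
  have h' := LinearMap.congr_fun h (p x)
  rw [← sub_eq_zero]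
  change p (projT n _) - p (projT n x) = 0
  rw [← map_sub, ← map_sub]
  refine hp.map_projT _ n ?_
  rw [map_sub, sub_eq_zero]
  exact h'

lemma proj_mul_ι (n : ℕ) (b : B) (v : V) : hp.proj (n + 1) (b * p (TensorAlgebra.ι k v)) =
    hp.proj n b * p (TensorAlgebra.ι k v) := by
  obtain ⟨x, rfl⟩ := hp.surjective b
  rw [← map_mul, proj_apply, proj_apply, projT_mul_right (ι_mem_tensorPow_one v), map_mul]

lemma proj_zero_mul_ι (b : B) (v : V) : hp.proj 0 (b * p (TensorAlgebra.ι k v)) = 0 := by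
  obtain ⟨x, rfl⟩ := hp.surjective b
  rw [← map_mul, proj_apply, projT_mul_right_of_lt (ι_mem_tensorPow_one v) one_pos, map_zero]

lemma proj_mul_left {m : ℕ} {x : TensorAlgebra k V} (hx : x ∈ tensorPow k V m) (n : ℕ) (b : B) :
    hp.proj (m + n) (p x * b) = p x * hp.proj n b := by
  obtain ⟨y, rfl⟩ := hp.surjective b
  rw [← map_mul, proj_apply, proj_apply, projT_mul_left hx, map_mul]

lemma proj_mul_left_of_lt {m n : ℕ} {x : TensorAlgebra k V} (hx : x ∈ tensorPow k V m) (h : n < m)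
    (b : B) : hp.proj n (p x * b) = 0 := by
  obtain ⟨y, rfl⟩ := hp.surjective b
  rw [← map_mul, proj_apply, projT_mul_left_of_lt hx h, map_zero]

lemma exists_sum_proj (b : B) : ∃ N, ∀ M, N ≤ M → ∑ n ∈ Finset.range M, hp.proj n b = b := by
  obtain ⟨x, rfl⟩ := hp.surjective b
  obtain ⟨N, hN⟩ := exists_sum_projT x
  refine ⟨N, fun M hM => ?_⟩
  simp only [proj_apply]
  rw [← map_sum, hN M hM]

/-- The projection onto the component of degree `n` of the first factor of `B ⊗ T(V)`. -/
noncomputable def tproj (n : ℕ) : B ⊗[k] TensorAlgebra k V →ₗ[k] B ⊗[k] TensorAlgebra k V :=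
  (hp.proj n).rTensor _

lemma tproj_tmul (n : ℕ) (b : B) (t : TensorAlgebra k V) :
    hp.tproj n (b ⊗ₜ t) = hp.proj n b ⊗ₜ t := rfl

lemma tproj_mem {J : Submodule k (TensorAlgebra k V)} (n : ℕ) {z : B ⊗[k] TensorAlgebra k V}
    (hz : z ∈ J.baseChange B) : hp.tproj n z ∈ J.baseChange B := by
  refine baseChange_induction (motive := fun z => hp.tproj n z ∈ J.baseChange B)
    (by rw [map_zero]; exact zero_mem _)
    (fun b x hx => Submodule.tmul_mem_baseChange_of_mem _ hx)
    (fun x y hx hy => by rw [map_add]; exact add_mem hx hy) hz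

lemma exists_sum_tproj (z : B ⊗[k] TensorAlgebra k V) :
    ∃ N, ∀ M, N ≤ M → ∑ n ∈ Finset.range M, hp.tproj n z = z := by
  induction z with
  | zero => exact ⟨0, fun M _ => by simp⟩
  | tmul b t =>
    obtain ⟨N, hN⟩ := hp.exists_sum_proj b
    refine ⟨N, fun M hM => ?_⟩
    simp only [tproj_tmul]
    rw [← TensorProduct.sum_tmul, hN M hM]
  | add x y hx hy =>
    obtain ⟨N, hN⟩ := hx
    obtain ⟨N', hN'⟩ := hy
    refine ⟨max N N', fun M hM => ?_⟩
    simp only [map_add]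
    rw [Finset.sum_add_distrib, hN M (le_of_max_le_left hM), hN' M (le_of_max_le_right hM)]

lemma tproj_shift (n : ℕ) (z : B ⊗[k] TensorAlgebra k V) :
    hp.tproj (n + 1) (shift p z) = shift p (hp.tproj n z) := by
  induction z with
  | zero => simp
  | add x y hx hy => simp only [map_add, hx, hy]
  | tmul b t =>
    let N : Submodule k (TensorAlgebra k V) := LinearMap.eqLocus
      (hp.tproj (n + 1) ∘ₗ (shift p).restrictScalars k ∘ₗ TensorProduct.mk k B _ b)
      ((shift p).restrictScalars k ∘ₗ hp.tproj n ∘ₗ TensorProduct.mk k B _ b)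
    have h : t ∈ N := mem_of_one_mem_of_ι_mul_mem
      (by simp [N, shift_tmul_one, tproj_tmul])
      (fun v y => by simp [N, shift_tmul_ι_mul, tproj_tmul, proj_mul_ι]) t
    exact h

lemma tproj_zero_shift (z : B ⊗[k] TensorAlgebra k V) : hp.tproj 0 (shift p z) = 0 := by
  induction z with
  | zero => simp
  | add x y hx hy => simp only [map_add, hx, hy, add_zero]
  | tmul b t =>
    let N : Submodule k (TensorAlgebra k V) := LinearMap.ker
      (hp.tproj 0 ∘ₗ (shift p).restrictScalars k ∘ₗ TensorProduct.mk k B _ b)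
    have h : t ∈ N := mem_of_one_mem_of_ι_mul_mem
      (by simp [N, shift_tmul_one])
      (fun v y => by simp [N, shift_tmul_ι_mul, tproj_tmul, proj_zero_mul_ι]) t
    exact h

lemma tproj_shift_pow (n c : ℕ) (z : B ⊗[k] TensorAlgebra k V) :
    hp.tproj (n + c) ((shift p ^ c) z) = (shift p ^ c) (hp.tproj n z) := by
  induction c with
  | zero => rfl
  | succ c ih =>
    rw [pow_succ', Module.End.mul_apply, Module.End.mul_apply, ← add_assoc, tproj_shift, ih]

lemma tproj_shift_pow_of_lt {n c : ℕ} (h : n < c) (z : B ⊗[k] TensorAlgebra k V) :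
    hp.tproj n ((shift p ^ c) z) = 0 := by
  induction c generalizing n with
  | zero => lia
  | succ c ih =>
    rw [pow_succ', Module.End.mul_apply]
    match n with
    | 0 => exact hp.tproj_zero_shift _
    | n + 1 => rw [tproj_shift, ih (by lia), map_zero]

lemma tproj_smul {m : ℕ} {x : TensorAlgebra k V} (hx : x ∈ tensorPow k V m) (n : ℕ)
    (z : B ⊗[k] TensorAlgebra k V) : hp.tproj (m + n) (p x • z) = p x • hp.tproj n z := by
  induction z with
  | zero => simp
  | add y z hy hz => simp only [smul_add, map_add, hy, hz]
  | tmul b t =>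
    rw [TensorProduct.smul_tmul', smul_eq_mul, tproj_tmul, proj_mul_left hp hx, tproj_tmul,
      TensorProduct.smul_tmul', smul_eq_mul]

lemma tproj_smul_of_lt {m n : ℕ} {x : TensorAlgebra k V} (hx : x ∈ tensorPow k V m) (h : n < m)
    (z : B ⊗[k] TensorAlgebra k V) : hp.tproj n (p x • z) = 0 := by
  induction z with
  | zero => simp
  | add y z hy hz => simp only [smul_add, map_add, hy, hz, add_zero]
  | tmul b t =>
    rw [TensorProduct.smul_tmul', smul_eq_mul, tproj_tmul, proj_mul_left_of_lt hp hx h,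
      TensorProduct.zero_tmul]

/-- Since `w` has only components of positive degree, the degree `n` component of `w • z` involves
only components of `z` of degree below `n`. -/
lemma tproj_smul_mem {N : Submodule B (B ⊗[k] TensorAlgebra k V)} {w : B} (hw : hp.proj 0 w = 0)
    {z : B ⊗[k] TensorAlgebra k V} {n : ℕ} (h : ∀ m < n, hp.tproj m z ∈ N) :
    hp.tproj n (w • z) ∈ N := by
  obtain ⟨M, hM⟩ := hp.exists_sum_proj w
  rw [← hM M le_rfl, Finset.sum_smul, map_sum]
  refine Submodule.sum_mem _ fun i _ => ?_
  obtain ⟨x, rfl⟩ := hp.surjective w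
  match i with
  | 0 => rw [hw, zero_smul, map_zero]; exact zero_mem _
  | i + 1 =>
    rw [proj_apply]
    by_cases hi : i + 1 ≤ n
    · obtain ⟨j, rfl⟩ := Nat.exists_eq_add_of_le hi
      rw [tproj_smul hp (projT_mem _ _)]
      exact N.smul_mem _ (h j (by lia))
    · rw [tproj_smul_of_lt hp (projT_mem _ _) (by lia)]
      exact zero_mem _

end IsGradedQuotient

section Kernel

variable (π : B →ₐ[k] A)

/-- For a `k`-linear section `σ` of `π`, the operator `(id - σ π) ⊗ id` fixes the kernel and maps
every pure tensor to one whose first factor is killed by `π`. -/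
lemma ker_rTensor_induction (hπ : Function.Surjective π) {J : Submodule k (TensorAlgebra k V)}
    {motive : B ⊗[k] TensorAlgebra k V → Prop} (zero : motive 0)
    (tmul : ∀ b, π b = 0 → ∀ x ∈ J, motive (b ⊗ₜ x))
    (add : ∀ x y, motive x → motive y → motive (x + y))
    {z : B ⊗[k] TensorAlgebra k V} (hz : z ∈ J.baseChange B)
    (h : π.toLinearMap.rTensor _ z = 0) : motive z := by
  obtain ⟨σ, hσ⟩ := LinearMap.exists_rightInverse_of_surjective π.toLinearMap
    (LinearMap.range_eq_top.2 hπ)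
  have h' : (LinearMap.id - σ ∘ₗ π.toLinearMap).rTensor _ z = z := by
    rw [LinearMap.rTensor_sub, LinearMap.sub_apply, LinearMap.rTensor_comp, LinearMap.comp_apply,
      h, map_zero, sub_zero, LinearMap.rTensor_id, LinearMap.id_apply]
  rw [← h']
  refine baseChange_induction
    (motive := fun z => motive ((LinearMap.id - σ ∘ₗ π.toLinearMap).rTensor _ z))
    (by rwa [map_zero]) (fun b x hx => tmul _ ?_ x hx)
    (fun x y hx hy => by rw [map_add]; exact add _ _ hx hy) hz
  have := LinearMap.congr_fun hσ (π b)
  simp only [LinearMap.comp_apply, LinearMap.id_apply, AlgHom.toLinearMap_apply] at this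
  simp [this]

end Kernel

section Free

variable {p : TensorAlgebra k V →ₐ[k] B} (hp : IsGradedQuotient p) (π : B →ₐ[k] A)

/-- The homogeneous component of the kernel of `π : B → A`. -/
noncomputable def kerComp (p : TensorAlgebra k V →ₐ[k] B) (π : B →ₐ[k] A) (n : ℕ) :
    Submodule k B :=
  LinearMap.ker π.toLinearMap ⊓ (tensorPow k V n).map p.toLinearMap

/-- The homogeneous component of the decomposable part of the kernel of `π : B → A`. -/
noncomputable def kerDecomp (p : TensorAlgebra k V →ₐ[k] B) (π : B →ₐ[k] A) : ℕ → Submodule k B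
  | 0 => ⊥
  | n + 1 => kerComp p π n * (tensorPow k V 1).map p.toLinearMap

lemma kerDecomp_le : ∀ n, kerDecomp p π n ≤ kerComp p π n
  | 0 => bot_le
  | n + 1 => by
    refine Submodule.mul_le.2 ?_
    rintro b ⟨hb, x, hx, rfl⟩ _ ⟨y, hy, rfl⟩
    refine ⟨?_, x * y, ?_, ?_⟩
    · rw [SetLike.mem_coe, LinearMap.mem_ker, AlgHom.toLinearMap_apply] at hb ⊢
      rw [map_mul, hb, zero_mul]
    · rw [tensorPow, pow_add]
      exact Submodule.mul_mem_mul hx hy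
    · simp

/-- A choice of homogeneous generators of degree `n` of the kernel of `π : B → A` as a right
ideal. -/
noncomputable def kerGen (p : TensorAlgebra k V →ₐ[k] B) (π : B →ₐ[k] A) (n : ℕ) : Submodule k B :=
  (IsModularLattice.exists_disjoint_and_sup_eq (kerDecomp_le (p := p) π n)).choose

lemma kerGen_disjoint (n : ℕ) : Disjoint (kerDecomp p π n) (kerGen p π n) :=
  (IsModularLattice.exists_disjoint_and_sup_eq (kerDecomp_le (p := p) π n)).choose_spec.1

lemma kerDecomp_sup_kerGen (n : ℕ) : kerDecomp p π n ⊔ kerGen p π n = kerComp p π n :=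
  (IsModularLattice.exists_disjoint_and_sup_eq (kerDecomp_le (p := p) π n)).choose_spec.2

/-- A space of homogeneous generators of the kernel of `π : B → A` as a right ideal. -/
noncomputable def kerGens (p : TensorAlgebra k V →ₐ[k] B) (π : B →ₐ[k] A) : Submodule k B :=
  ⨆ n, kerGen p π n

variable {π}

lemma kerGen_le (n : ℕ) : kerGen p π n ≤ kerComp p π n := by
  rw [← kerDecomp_sup_kerGen]
  exact le_sup_right

lemma map_eq_zero_of_mem_kerGens {w : B} (hw : w ∈ kerGens p π) : π w = 0 := by
  have h : kerGens p π ≤ LinearMap.ker π.toLinearMap :=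
    iSup_le fun n => (kerGen_le n).trans inf_le_left
  exact h hw

lemma proj_mem_kerComp (hπ : IsGradedQuotient (π.comp p)) (n : ℕ) {b : B} (hb : π b = 0) :
    hp.proj n b ∈ kerComp p π n := by
  obtain ⟨x, rfl⟩ := hp.surjective b
  rw [hp.proj_apply]
  exact ⟨hπ.map_projT x n hb, _, projT_mem n x, rfl⟩

lemma proj_mem_kerGen (n : ℕ) {w : B} (hw : w ∈ kerGens p π) : hp.proj n w ∈ kerGen p π n := by
  have h : kerGens p π ≤ (kerGen p π n).comap (hp.proj n) := by
    refine iSup_le fun m b hb => ?_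
    obtain ⟨-, x, hx, rfl⟩ := kerGen_le m hb
    rw [Submodule.mem_comap, AlgHom.toLinearMap_apply, hp.proj_apply]
    by_cases hm : m = n
    · subst hm
      rwa [projT_of_mem hx]
    · rw [projT_of_mem_ne hx hm, map_zero]
      exact zero_mem _
  exact h hw

lemma proj_mem_kerDecomp (hπ : IsGradedQuotient (π.comp p)) {b : B}
    (hb : b ∈ LinearMap.ker π.toLinearMap * (tensorPow k V 1).map p.toLinearMap) (n : ℕ) :
    hp.proj n b ∈ kerDecomp p π n := by
  induction hb using Submodule.mul_induction_on' with
  | mem_mul_mem b hb c hc =>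
    obtain ⟨x, hx, rfl⟩ := hc
    obtain ⟨v, rfl⟩ := exists_ι_of_mem_tensorPow_one hx
    rw [AlgHom.toLinearMap_apply]
    match n with
    | 0 => rw [hp.proj_zero_mul_ι]; exact zero_mem _
    | n + 1 =>
      rw [hp.proj_mul_ι]
      exact Submodule.mul_mem_mul (proj_mem_kerComp hp hπ n hb) ⟨_, hx, rfl⟩
  | add x _ y _ hx hy => rw [map_add]; exact add_mem hx hy

lemma eq_zero_of_proj_eq_zero {b : B} (h : ∀ n, hp.proj n b = 0) : b = 0 := by
  obtain ⟨N, hN⟩ := hp.exists_sum_proj b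
  rw [← hN N le_rfl]
  exact Finset.sum_eq_zero fun n _ => h n

-- Checked degree by degree: each `kerGen p π n` was chosen as a complement of the decomposables.
include hp in
lemma eq_zero_of_mem_kerGens (hπ : IsGradedQuotient (π.comp p)) {b : B} (hb : b ∈ kerGens p π)
    (hb' : b ∈ LinearMap.ker π.toLinearMap * (tensorPow k V 1).map p.toLinearMap) : b = 0 :=
  eq_zero_of_proj_eq_zero hp fun n => Submodule.disjoint_def.1 (kerGen_disjoint π n) _
    (proj_mem_kerDecomp hp hπ hb' n) (proj_mem_kerGen hp n hb)

/-- Graded Nakayama: a decomposable element of degree `n + 1` has its left factor in degree `n`,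
already generated by induction. -/
lemma kerComp_le : ∀ n, kerComp p π n ≤ kerGens p π * ⊤
  | 0 => by
    rw [← kerDecomp_sup_kerGen, kerDecomp, bot_sup_eq]
    intro b hb
    rw [← mul_one b]
    exact Submodule.mul_mem_mul (le_iSup (kerGen p π) 0 hb) trivial
  | n + 1 => by
    rw [← kerDecomp_sup_kerGen, kerDecomp]
    refine sup_le ((mul_le_mul' (kerComp_le n) le_top).trans ?_) fun b hb => ?_
    · rw [mul_assoc]
      exact mul_le_mul' le_rfl le_top
    · rw [← mul_one b]
      exact Submodule.mul_mem_mul (le_iSup (kerGen p π) (n + 1) hb) trivial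

include hp in
lemma mem_kerGens_mul (hπ : IsGradedQuotient (π.comp p)) {b : B} (hb : π b = 0) :
    b ∈ kerGens p π * ⊤ := by
  obtain ⟨N, hN⟩ := hp.exists_sum_proj b
  rw [← hN N le_rfl]
  exact Submodule.sum_mem _ fun n _ => kerComp_le n (proj_mem_kerComp hp hπ n hb)

/-- The degree `0` part of `B` consists of scalars, and no nonzero scalar is killed by a map to a
nontrivial algebra. -/
lemma proj_zero_of_mem_kerGens [Nontrivial A] {b : B} (hb : b ∈ kerGens p π) :
    hp.proj 0 b = 0 := by
  obtain ⟨h, x, hx, hxb⟩ := kerGen_le 0 (proj_mem_kerGen hp 0 hb)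
  rw [tensorPow, pow_zero] at hx
  obtain ⟨r, rfl⟩ := Submodule.mem_one.1 hx
  rw [AlgHom.toLinearMap_apply, AlgHom.commutes] at hxb
  rw [← hxb, SetLike.mem_coe, LinearMap.mem_ker, AlgHom.toLinearMap_apply, AlgHom.commutes,
    map_eq_zero_iff _ (algebraMap k A).injective] at h
  rw [← hxb, h, map_zero]

section Combination

variable {ι : Type u} (w : ι → B)

/-- The combination `∑ i, w i • f i`. -/
noncomputable def comb {M : Type u} [AddCommGroup M] [Module B M] : (ι →₀ M) →+ M :=
  Finsupp.liftAddHom fun i => DistribSMul.toAddMonoidHom M (w i)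

variable {M N : Type u} [AddCommGroup M] [Module B M] [AddCommGroup N] [Module B N]

lemma comb_single (i : ι) (y : M) : comb w (Finsupp.single i y) = w i • y := by
  simp [comb]

lemma map_comb (g : M →ₗ[B] N) (f : ι →₀ M) :
    g (comb w f) = comb w (f.mapRange g (map_zero g)) := by
  induction f using Finsupp.induction_linear with
  | zero => simp
  | add f f' hf hf' => rw [map_add, map_add, hf, hf', Finsupp.mapRange_add (map_add g), map_add]
  | single i y => simp [comb_single]

variable {w}

lemma comb_induction {P : M → Prop} (zero : P 0) (smul : ∀ i y, P (w i • y))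
    (add : ∀ x y, P x → P y → P (x + y)) (f : ι →₀ M) : P (comb w f) := by
  induction f using Finsupp.induction_linear with
  | zero => rwa [map_zero]
  | add f f' hf hf' => rw [map_add]; exact add _ _ hf hf'
  | single i y => rw [comb_single]; exact smul i y

lemma comb_mem {P : Submodule B M} {f : ι →₀ M} (hf : ∀ i, f i ∈ P) : comb w f ∈ P := by
  rw [comb, Finsupp.liftAddHom_apply]
  exact Submodule.sum_mem _ fun i _ => P.smul_mem _ (hf i)

end Combination

/-- Elements `w i` that generate the kernel of `π : B → A` as a right ideal and are linearly
independent modulo decomposables. -/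
structure IsMinimalGenerating (π : B →ₐ[k] A) {ι : Type u} (w : ι → B) : Prop where
  proj_zero : ∀ i, hp.proj 0 (w i) = 0
  map_eq_zero : ∀ i, π (w i) = 0
  exists_comb : ∀ b, π b = 0 → ∃ t : ι →₀ B, comb w t = b
  eq_zero : ∀ c : ι →₀ k, Finsupp.linearCombination k w c ∈
    LinearMap.ker π.toLinearMap * (tensorPow k V 1).map p.toLinearMap → c = 0

/-- The `w i` form a `k`-basis of the complement `kerGens` of the decomposables. -/
lemma exists_isMinimalGenerating [Nontrivial A] (hπ : IsGradedQuotient (π.comp p)) :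
    ∃ (ι : Type u) (w : ι → B), IsMinimalGenerating hp π w := by
  let e := Module.Basis.ofVectorSpace k (kerGens p π)
  refine ⟨_, fun i => e i, ⟨fun i => proj_zero_of_mem_kerGens hp (e i).2,
    fun i => map_eq_zero_of_mem_kerGens (e i).2, fun b hb => ?_, fun c hc => ?_⟩⟩
  · have h := mem_kerGens_mul hp hπ hb
    clear hb
    induction h using Submodule.mul_induction_on' with
    | mem_mul_mem x hx y hy =>
      have hc : ∀ c : _ →₀ k, ∃ t : _ →₀ B, comb (fun i => (e i : B)) t =
          Finsupp.linearCombination k (fun i => (e i : B)) c * y := by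
        intro c
        induction c using Finsupp.induction_linear with
        | zero => exact ⟨0, by simp⟩
        | add c c' hc hc' =>
          obtain ⟨t, ht⟩ := hc
          obtain ⟨t', ht'⟩ := hc'
          exact ⟨t + t', by rw [map_add, map_add, add_mul, ht, ht']⟩
        | single i r => exact ⟨Finsupp.single i (r • y), by simp [comb_single]⟩
      have hx' := congrArg (kerGens p π).subtype (e.linearCombination_repr ⟨x, hx⟩)
      rw [Finsupp.apply_linearCombination] at hx'
      obtain ⟨t, ht⟩ := hc (e.repr ⟨x, hx⟩)
      refine ⟨t, ht.trans ?_⟩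
      exact congrArg (· * y) hx'
    | add x hx y hy ihx ihy =>
      obtain ⟨t, ht⟩ := ihx
      obtain ⟨t', ht'⟩ := ihy
      exact ⟨t + t', by rw [map_add, ht, ht']⟩
  · have h := eq_zero_of_mem_kerGens hp hπ (b := Finsupp.linearCombination k (fun i => (e i : B)) c)
      (by
        rw [Finsupp.linearCombination_apply]
        exact Submodule.sum_mem _ fun i _ => Submodule.smul_mem _ _ (e i).2) hc
    have hi : LinearIndependent k fun i => (e i : B) :=
      e.linearIndependent.map' (kerGens p π).subtype (Submodule.ker_subtype _)
    exact (linearIndependent_iff.1 hi) c h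

end Free

end GradedQuotient

/-! ### Descent of exactness of the Koszul complex along `π : B → A`. -/

section KoszulDescent

variable {k : Type u} [Field k] {V : Type u} [AddCommGroup V] [Module k V]
variable {A B : Type u} [Ring A] [Algebra k A] [Ring B] [Algebra k B]
variable {p : TensorAlgebra k V →ₐ[k] B} {hp : IsGradedQuotient p} {π : B →ₐ[k] A}
variable {ι : Type u} {w : ι → B}

lemma rTensor_smul (b : B) (z : B ⊗[k] TensorAlgebra k V) :
    π.toLinearMap.rTensor _ (b • z) = π b • π.toLinearMap.rTensor (TensorAlgebra k V) z :=
  map_smulₛₗ (semiMap π) b z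

/-- A linear contraction of the complex in degree `0`: `H` splits off the last letter of a lift to
`T(V)`, and `E` is the constant term. -/
lemma shift_eq_sub (hp : IsGradedQuotient p) : ∃ (H : B →ₗ[k] B ⊗[k] TensorAlgebra k V)
    (E : B →ₗ[k] k), ∀ b, H b ∈ (tensorPow k V 1).baseChange B ∧
      b ⊗ₜ[k] 1 = shift p (H b) + E b • (1 ⊗ₜ[k] 1) := by
  obtain ⟨σ, hσ⟩ := LinearMap.exists_rightInverse_of_surjective p.toLinearMap
    (LinearMap.range_eq_top.2 hp.surjective)
  refine ⟨splitLast p ∘ₗ σ, tensorAug.toLinearMap ∘ₗ σ, fun b => ⟨splitLast_mem p _, ?_⟩⟩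
  have h := shift_splitLast p (σ b - algebraMap k _ (tensorAug (σ b)))
    (by rw [map_sub, AlgHom.commutes]; exact sub_self _)
  have hb : p (σ b) = b := LinearMap.congr_fun hσ b
  rw [Algebra.algebraMap_eq_smul_one, map_sub, map_smul, splitLast_one, smul_zero, sub_zero,
    map_sub, map_smul, map_one, hb, TensorProduct.sub_tmul, ← TensorProduct.smul_tmul'] at h
  change _ = shift p (splitLast p (σ b)) + tensorAug (σ b) • _
  rw [h, sub_add_cancel]

/-- The coordinates of an element of `B ⊗ T(V)` with respect to a basis of `T(V)`. -/
noncomputable def tcoord (B : Type u) [Ring B] [Algebra k B]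
    (j : Module.Basis.ofVectorSpaceIndex k (TensorAlgebra k V)) :
    B ⊗[k] TensorAlgebra k V →ₗ[B] B :=
  ((Module.Basis.ofVectorSpace k (TensorAlgebra k V)).baseChange B).coord j

lemma eq_zero_of_tcoord_eq_zero {z : B ⊗[k] TensorAlgebra k V} (h : ∀ j, tcoord B j z = 0) :
    z = 0 :=
  ((Module.Basis.ofVectorSpace k (TensorAlgebra k V)).baseChange B).ext_elem fun j => by
    rw [map_zero]
    exact h j

lemma tcoord_tproj (hp : IsGradedQuotient p) (n : ℕ)
    (j : Module.Basis.ofVectorSpaceIndex k (TensorAlgebra k V)) (z : B ⊗[k] TensorAlgebra k V) :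
    tcoord B j (hp.tproj n z) = hp.proj n (tcoord B j z) := by
  induction z with
  | zero => simp only [map_zero]
  | add x y hx hy => simp only [map_add, hx, hy]
  | tmul b t => simp [hp.tproj_tmul, tcoord, Module.Basis.baseChange_repr_tmul]

lemma map_shift_pow (c : ℕ) (z : B ⊗[k] TensorAlgebra k V) :
    π.toLinearMap.rTensor _ ((shift p ^ c) z) =
      (shift (π.comp p) ^ c) (π.toLinearMap.rTensor _ z) := by
  induction c with
  | zero => rfl
  | succ c ih => rw [pow_succ', pow_succ', Module.End.mul_apply, Module.End.mul_apply, map_shift,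
      ih]

lemma rTensor_mem (π : B →ₐ[k] A) {J : Submodule k (TensorAlgebra k V)}
    {z : B ⊗[k] TensorAlgebra k V} (hz : z ∈ J.baseChange B) :
    π.toLinearMap.rTensor _ z ∈ J.baseChange A := by
  have h : J.baseChange B ≤ (J.baseChange A).comap (semiMap π) :=
    baseChange_le fun x hx => Submodule.tmul_mem_baseChange_of_mem _ hx
  exact h hz

lemma exists_rTensor_eq (hπ : Function.Surjective π) {J : Submodule k (TensorAlgebra k V)}
    {y : A ⊗[k] TensorAlgebra k V} (hy : y ∈ J.baseChange A) :
    ∃ z ∈ J.baseChange B, π.toLinearMap.rTensor _ z = y := by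
  refine baseChange_induction (motive := fun y => ∃ z ∈ J.baseChange B,
    π.toLinearMap.rTensor _ z = y) ⟨0, zero_mem _, map_zero _⟩ (fun a x hx => ?_)
    (fun x y hx hy => ?_) hy
  · obtain ⟨b, rfl⟩ := hπ a
    exact ⟨_, Submodule.tmul_mem_baseChange_of_mem b hx, rfl⟩
  · obtain ⟨x', hx', rfl⟩ := hx
    obtain ⟨y', hy', rfl⟩ := hy
    exact ⟨x' + y', add_mem hx' hy', map_add _ _ _⟩

namespace IsMinimalGenerating

variable (hw : IsMinimalGenerating hp π w)
include hw

lemma exists_comb_tensor (hπ : Function.Surjective π) {J : Submodule k (TensorAlgebra k V)}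
    {z : B ⊗[k] TensorAlgebra k V} (hz : z ∈ J.baseChange B)
    (h : π.toLinearMap.rTensor _ z = 0) :
    ∃ f : ι →₀ B ⊗[k] TensorAlgebra k V, (∀ i, f i ∈ J.baseChange B) ∧ comb w f = z := by
  refine ker_rTensor_induction (J := J) (motive := fun z =>
    ∃ f : ι →₀ B ⊗[k] TensorAlgebra k V, (∀ i, f i ∈ J.baseChange B) ∧ comb w f = z)
    π hπ ⟨0, by simp⟩ (fun b hb x hx => ?_) (fun x y hx hy => ?_) hz h
  · obtain ⟨t, rfl⟩ := hw.exists_comb b hb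
    have hf := map_comb w (TensorProduct.AlgebraTensorModule.mk k B B (TensorAlgebra k V) |>.flip x)
      t
    exact ⟨_, fun i => Submodule.tmul_mem_baseChange_of_mem _ hx, hf.symm⟩
  · obtain ⟨f, hf, rfl⟩ := hx
    obtain ⟨g, hg, rfl⟩ := hy
    exact ⟨f + g, fun i => add_mem (hf i) (hg i), map_add _ _ _⟩

lemma rTensor_comb (f : ι →₀ B ⊗[k] TensorAlgebra k V) :
    π.toLinearMap.rTensor _ (comb w f) = 0 :=
  comb_induction (P := fun z => π.toLinearMap.rTensor _ z = 0) (map_zero _)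
    (fun i y => by rw [rTensor_smul, hw.map_eq_zero, zero_smul])
    (fun x y hx hy => by rw [map_add, hx, hy, add_zero]) f

variable {R : Submodule k (TensorAlgebra k V)} {s : ℕ}
  (hs : 2 ≤ s) (hR : R ≤ tensorPow k V s) (hpR : ∀ x ∈ R, p x = 0) (hπ : Function.Surjective π)
  -- With `I` the kernel of `π`, this is exactness of `I ⊗ R → I ⊗ V → I` at `I ⊗ V`, that is,
  -- `Tor_1^B(I, k) = 0`.
  (h₁ : ∀ x ∈ (tensorPow k V 1).baseChange B, π.toLinearMap.rTensor _ x = 0 → shift p x = 0 →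
    ∃ y ∈ R.baseChange B, π.toLinearMap.rTensor _ y = 0 ∧ (shift p ^ (s - 1)) y = x)
include hs hR hpR hπ h₁

/-- A relation `∑ w i * t i = 0` has no constant coefficients by minimality, and the vanishing
`Tor_1` lifts it to a relation with coefficients in `B ⊗ T(V)`, one degree lower in `B`. -/
lemma exists_shift_eq_of_comb_eq_zero {t : ι →₀ B} (ht : comb w t = 0) :
    ∃ f : ι →₀ B ⊗[k] TensorAlgebra k V, comb w f = 0 ∧ ∀ i, shift p (f i) = t i ⊗ₜ 1 := by
  obtain ⟨H, E, hHE⟩ := shift_eq_sub hp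
  have hsum : comb w t ⊗ₜ[k] (1 : TensorAlgebra k V) = shift p (comb w (t.mapRange H (map_zero H)))
      + Finsupp.linearCombination k w (t.mapRange E (map_zero E)) ⊗ₜ 1 := by
    clear ht
    induction t using Finsupp.induction_linear with
    | zero => simp
    | add t t' ht ht' =>
      rw [map_add, TensorProduct.add_tmul, ht, ht', Finsupp.mapRange_add (map_add H),
        Finsupp.mapRange_add (map_add E), map_add, map_add, map_add, TensorProduct.add_tmul]
      abel
    | single i b =>
      rw [comb_single, smul_eq_mul, Finsupp.mapRange_single, Finsupp.mapRange_single, comb_single,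
        Finsupp.linearCombination_single, map_smul, ← smul_eq_mul, ← TensorProduct.smul_tmul',
        (hHE b).2, smul_add, ← TensorProduct.smul_tmul', smul_comm, TensorProduct.smul_tmul',
        smul_eq_mul, mul_one]
  set x := comb w (t.mapRange H (map_zero H)) with hx
  have hxV : x ∈ (tensorPow k V 1).baseChange B := comb_mem fun i => (hHE _).1
  have hxπ : π.toLinearMap.rTensor _ x = 0 := hw.rTensor_comb _
  -- Since `x` lies in `I ⊗ V`, its image under `shift` lies in `I * V`, the decomposables; so the
  -- constant terms of `t` form a combination of the `w i` that is decomposable, hence zero.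
  obtain ⟨u, hu, hxu⟩ : ∃ u ∈ LinearMap.ker π.toLinearMap * (tensorPow k V 1).map p.toLinearMap,
      shift p x = u ⊗ₜ 1 := by
    refine ker_rTensor_induction (J := tensorPow k V 1) (motive := fun x => ∃ u ∈
      LinearMap.ker π.toLinearMap * (tensorPow k V 1).map p.toLinearMap, shift p x = u ⊗ₜ 1)
      π hπ ⟨0, zero_mem _, by simp⟩ (fun b hb y hy => ?_) (fun x y hx hy => ?_) hxV hxπ
    · obtain ⟨v, rfl⟩ := exists_ι_of_mem_tensorPow_one hy
      exact ⟨_, Submodule.mul_mem_mul hb ⟨_, hy, rfl⟩, shift_tmul_ι p b v⟩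
    · obtain ⟨u, hu, hxu⟩ := hx
      obtain ⟨u', hu', hyu'⟩ := hy
      exact ⟨u + u', add_mem hu hu', by rw [map_add, hxu, hyu', TensorProduct.add_tmul]⟩
  rw [ht, hxu, ← TensorProduct.add_tmul] at hsum
  have hlin := tmul_one_injective hsum
  have hE : t.mapRange E (map_zero E) = 0 := by
    refine hw.eq_zero _ ?_
    rw [← neg_eq_of_add_eq_zero_right hlin.symm]
    exact neg_mem hu
  rw [hE, map_zero, add_zero] at hlin
  rw [← hlin, TensorProduct.zero_tmul] at hxu
  obtain ⟨y, hy, hyπ, hyx⟩ := h₁ x hxV hxπ hxu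
  obtain ⟨g, hg, rfl⟩ := hw.exists_comb_tensor hπ hy hyπ
  -- Subtracting `δ_2 g` makes the combination vanish, and it does not change the image under
  -- `shift` because `shift ^ s` kills `B ⊗ R`.
  refine ⟨t.mapRange H (map_zero H) - g.mapRange (shift p ^ (s - 1)) (map_zero _), ?_, fun i => ?_⟩
  · rw [map_sub, ← hx, ← map_comb, hyx, sub_self]
  · have hEi : E (t i) = 0 := DFunLike.congr_fun hE i
    have hgi : (shift p ^ s) (g i) = 0 :=
      shift_pow_eq_zero (N := 1) hR hpR (by rw [mul_one]; exact hg i)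
    rw [Finsupp.sub_apply, Finsupp.mapRange_apply, Finsupp.mapRange_apply, map_sub,
      ← Module.End.mul_apply, ← pow_succ', Nat.sub_add_cancel (by lia), hgi, sub_zero, (hHE _).2,
      hEi, zero_smul, add_zero]

/-- Induction on the degree: the coordinates of the lifted relation along a basis of `T(V)` are
again relations among the `w i`, and `shift` raises the degree in `B` by one. -/
lemma proj_eq_zero_of_comb_eq_zero (n : ℕ) {t : ι →₀ B} (ht : comb w t = 0) (i : ι) :
    hp.proj n (t i) = 0 := by
  induction n generalizing t i with
  | zero =>
    obtain ⟨f, hf, hft⟩ := exists_shift_eq_of_comb_eq_zero hw hs hR hpR hπ h₁ ht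
    have h := hp.tproj_zero_shift (f i)
    rw [hft, hp.tproj_tmul, ← TensorProduct.zero_tmul B] at h
    exact tmul_one_injective h
  | succ n ih =>
    obtain ⟨f, hf, hft⟩ := exists_shift_eq_of_comb_eq_zero hw hs hR hpR hπ h₁ ht
    have h := hp.tproj_shift n (f i)
    have h0 : hp.tproj n (f i) = 0 := by
      refine eq_zero_of_tcoord_eq_zero fun j => ?_
      rw [tcoord_tproj]
      refine ih (t := f.mapRange (tcoord B j) (map_zero _)) ?_ i
      rw [← map_comb, hf, map_zero]
    rw [hft, hp.tproj_tmul, h0, map_zero, ← TensorProduct.zero_tmul B] at h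
    exact tmul_one_injective h

/-- Freeness of the kernel as a right `B`-module on the `w i`, in coordinates of `B ⊗ T(V)`. -/
lemma eq_zero_of_comb_eq_zero {f : ι →₀ B ⊗[k] TensorAlgebra k V} (hf : comb w f = 0) :
    f = 0 := by
  ext1 i
  refine eq_zero_of_tcoord_eq_zero fun j => eq_zero_of_proj_eq_zero hp fun n => ?_
  refine hw.proj_eq_zero_of_comb_eq_zero hs hR hpR hπ h₁ n
    (t := f.mapRange (tcoord B j) (map_zero _)) ?_ i
  rw [← map_comb, hf, map_zero]

end IsMinimalGenerating

/-- The Koszul complex of an `s`-homogeneous graded quotient `B` of `T(V)` is exact in degrees `≥ 2`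
if it becomes so after base change to some graded quotient of `B`. -/
theorem exists_shift_pow_eq_of_quotient [FiniteDimensional k V] [Nontrivial A]
    (hp : IsGradedQuotient p) (hπ : IsGradedQuotient (π.comp p))
    {R : Submodule k (TensorAlgebra k V)} {s : ℕ} (hs : 2 ≤ s) (hR : R ≤ tensorPow k V s)
    (hpR : ∀ x, p x = 0 ↔ x ∈ relIdeal R)
    (hA : ∀ n, ∀ x ∈ (koszulSpace R s (n + 2)).baseChange A,
      (shift (π.comp p) ^ step s (n + 1)) x = 0 →
        ∃ y ∈ (koszulSpace R s (n + 3)).baseChange A, (shift (π.comp p) ^ step s (n + 2)) y = x)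
    (n : ℕ) {x : B ⊗[k] TensorAlgebra k V} (hx : x ∈ (koszulSpace R s (n + 2)).baseChange B)
    (h : (shift p ^ step s (n + 1)) x = 0) :
    ∃ y ∈ (koszulSpace R s (n + 3)).baseChange B, (shift p ^ step s (n + 2)) y = x := by
  have hsurj : Function.Surjective π := Function.Surjective.of_comp hπ.surjective
  have hpR' : ∀ x ∈ R, p x = 0 := fun x hx => (hpR x).2 (TwoSidedIdeal.subset_span hx)
  have hlift : ∀ n, ∀ z ∈ (koszulSpace R s (n + 2)).baseChange B,
      π.toLinearMap.rTensor _ ((shift p ^ step s (n + 1)) z) = 0 →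
      ∃ y ∈ (koszulSpace R s (n + 3)).baseChange B,
        π.toLinearMap.rTensor _ (z - (shift p ^ step s (n + 2)) y) = 0 := by
    intro n z hz hz'
    rw [map_shift_pow] at hz'
    obtain ⟨y, hy, hyz⟩ := hA n _ (rTensor_mem π hz) hz'
    obtain ⟨y', hy', rfl⟩ := exists_rTensor_eq hsurj hy
    exact ⟨y', hy', by rw [map_sub, map_shift_pow, hyz, sub_self]⟩
  have h₁ : ∀ x ∈ (tensorPow k V 1).baseChange B, π.toLinearMap.rTensor _ x = 0 →
      shift p x = 0 →
      ∃ y ∈ R.baseChange B, π.toLinearMap.rTensor _ y = 0 ∧ (shift p ^ (s - 1)) y = x := by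
    intro x hx hxπ hxs
    obtain ⟨y, hy, rfl⟩ := exists_shift_pow_eq hs hR hp.surjective hpR hx hxs
    have hstep : step s 1 = s - 1 := if_pos (by decide)
    have hyJ : y ∈ (koszulSpace R s 2).baseChange B := by rwa [koszulSpace_two]
    -- The preimage `y` need not lie in `I ⊗ R`, but over `A` it is a cycle and hence a boundary;
    -- subtracting a lifted boundary moves it into `I ⊗ R`.
    obtain ⟨y', hy', hyy'⟩ := hlift 0 y hyJ (by rwa [hstep])
    refine ⟨y - (shift p ^ step s 2) y', sub_mem hy ?_, hyy', ?_⟩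
    · rw [← koszulSpace_two (R := R) (s := s)]
      exact shift_pow_mem p hs hR 2 hy'
    · have h0 := shift_pow_shift_pow_eq_zero hs hR hpR' 1 hy'
      rw [hstep] at h0
      rw [map_sub, h0, sub_zero]
  obtain ⟨ι, w, hw⟩ := exists_isMinimalGenerating hp hπ
  let D := ((koszulSpace R s (n + 3)).baseChange B).map (shift p ^ step s (n + 2))
  -- The degree `m` is that of the first tensor factor; an element is the sum of finitely many of
  -- its components.
  suffices hD : ∀ m, ∀ z ∈ (koszulSpace R s (n + 2)).baseChange B,
      (shift p ^ step s (n + 1)) z = 0 → hp.tproj m z ∈ D by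
    obtain ⟨N, hN⟩ := hp.exists_sum_tproj x
    have hxD : x ∈ D := by
      rw [← hN N le_rfl]
      exact sum_mem fun m _ => hD m x hx h
    exact hxD
  intro m
  induction m using Nat.strong_induction_on with
  | _ m ih =>
    intro z hz hz'
    obtain ⟨y, hy, hzy⟩ := hlift n z hz (by rw [hz', map_zero])
    have hmem : z - (shift p ^ step s (n + 2)) y ∈ (koszulSpace R s (n + 2)).baseChange B :=
      sub_mem hz (shift_pow_mem p hs hR (n + 2) hy)
    obtain ⟨f, hf, hfz⟩ := hw.exists_comb_tensor hsurj hmem hzy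
    have hcyc : (shift p ^ step s (n + 1)) (comb w f) = 0 := by
      rw [hfz, map_sub, hz', shift_pow_shift_pow_eq_zero hs hR hpR' (n + 1) hy, sub_zero]
    rw [map_comb] at hcyc
    -- By freeness each coefficient `f i` of the combination is itself a cycle.
    have hf0 := hw.eq_zero_of_comb_eq_zero hs hR hpR' hsurj h₁ hcyc
    have hz2 : z = (shift p ^ step s (n + 2)) y + comb w f := by rw [hfz, add_sub_cancel]
    rw [hz2, map_add]
    refine add_mem ?_ ?_
    · by_cases hm : step s (n + 2) ≤ m
      · obtain ⟨m', rfl⟩ := Nat.exists_eq_add_of_le' hm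
        rw [hp.tproj_shift_pow]
        exact ⟨_, hp.tproj_mem m' hy, rfl⟩
      · rw [hp.tproj_shift_pow_of_lt (by lia)]
        exact zero_mem _
    · rw [comb, Finsupp.liftAddHom_apply, Finsupp.sum, map_sum]
      -- As `w i` has no component of degree `0`, the induction hypothesis for the components of the
      -- cycles `f i` below `m` suffices.
      refine sum_mem fun i _ => hp.tproj_smul_mem (hw.proj_zero i) fun m' hm' => ?_
      exact ih m' hm' (f i) (hf i) (DFunLike.congr_fun hf0 i)

end KoszulDescent

/-! ### Limits of graded algebras computed degreewise. -/

section GradedLimit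
universe v

variable {k : Type u} [Field k] {X Z : Type v} [Ring X] [Algebra k X] [Ring Z] [Algebra k Z]
  {𝒳 : ℕ → Submodule k X} [GradedAlgebra 𝒳] {𝒵 : ℕ → Submodule k Z} [GradedAlgebra 𝒵]
  {S : Type*} {Y : S → Type v} [∀ s, Ring (Y s)] [∀ s, Algebra k (Y s)]
  {𝒴 : ∀ s, ℕ → Submodule k (Y s)} [∀ s, GradedAlgebra (𝒴 s)]

lemma eq_zero_of_gradedProj_eq_zero {x : X} (h : ∀ n, GradedAlgebra.proj 𝒳 n x = 0) : x = 0 := by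
  refine (DirectSum.decompose 𝒳).injective ?_
  ext n
  rw [DirectSum.decompose_zero]
  exact h n

set_option maxHeartbeats 1000000 in
/-- A cone of graded algebras that is a limit in each degree is a limit. -/
theorem existsUnique_lift (p : ∀ s, 𝒳 →ₐᵍ[k] 𝒴 s) (q : ∀ s, 𝒴 s →ₐᵍ[k] 𝒵) (r : 𝒳 →ₐᵍ[k] 𝒵)
    (hinj : ∀ n, ∀ x ∈ 𝒳 n, (∀ s, p s x = 0) → r x = 0 → x = 0)
    (hsurj : ∀ n (y : ∀ s, Y s) (z : Z), (∀ s, y s ∈ 𝒴 s n) → z ∈ 𝒵 n → (∀ s, q s (y s) = z) →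
      ∃ x ∈ 𝒳 n, (∀ s, p s x = y s) ∧ r x = z)
    {B : Type w} [Ring B] [Algebra k B] (ℬ : ℕ → Submodule k B) [GradedAlgebra ℬ]
    (f : ∀ s, ℬ →ₐᵍ[k] 𝒴 s) (g : ℬ →ₐᵍ[k] 𝒵) (hfg : ∀ s, (q s).comp (f s) = g) :
    ∃! h : ℬ →ₐᵍ[k] 𝒳, (∀ s, (p s).comp h = f s) ∧ r.comp h = g := by
  -- Joint injectivity of the cone yields uniqueness, and also that elementwise chosen lifts form a
  -- graded algebra map.
  have huniq : ∀ x y : X, (∀ s, p s x = p s y) → r x = r y → x = y := by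
    intro x y hp hr
    rw [← sub_eq_zero]
    refine eq_zero_of_gradedProj_eq_zero (𝒳 := 𝒳) fun n => hinj n _ (SetLike.coe_mem _)
      (fun s => ?_) ?_
    · rw [GradedAlgebra.proj_apply, map_directSumDecompose 𝒳 (𝒴 s), map_sub, hp, sub_self]
      simp
    · rw [GradedAlgebra.proj_apply, map_directSumDecompose 𝒳 𝒵, map_sub, hr, sub_self]
      simp
  have hex : ∀ n, ∀ b ∈ ℬ n, ∃ x ∈ 𝒳 n, (∀ s, p s x = f s b) ∧ r x = g b := fun n b hb =>
    hsurj n (fun s => f s b) (g b) (fun s => (f s).map_mem hb) (g.map_mem hb)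
      fun s => DFunLike.congr_fun (hfg s) b
  have hex' : ∀ b, ∃ x, (∀ s, p s x = f s b) ∧ r x = g b := by
    intro b
    induction b using DirectSum.Decomposition.inductionOn ℬ with
    | zero => exact ⟨0, by simp⟩
    | add b c hb hc =>
      obtain ⟨x, hx, hx'⟩ := hb
      obtain ⟨y, hy, hy'⟩ := hc
      exact ⟨x + y, fun s => by rw [map_add, map_add, hx, hy], by rw [map_add, map_add, hx', hy']⟩
    | @homogeneous i b =>
      obtain ⟨x, -, hx⟩ := hex i b b.2
      exact ⟨x, hx⟩
  choose h hp hr using hex'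
  obtain ⟨H, hH⟩ : ∃ H : ℬ →ₐᵍ[k] 𝒳, ∀ b, H b = h b := by
    refine ⟨⟨⟨⟨⟨⟨h, ?_⟩, ?_⟩, ?_, ?_⟩, ?_⟩, ?_⟩, fun b => rfl⟩
    · exact huniq _ _ (fun s => by rw [hp, map_one, map_one]) (by rw [hr, map_one, map_one])
    · exact fun b c => huniq _ _ (fun s => by simp only [hp, map_mul]) (by simp only [hr, map_mul])
    · exact huniq _ _ (fun s => by rw [hp, map_zero, map_zero]) (by rw [hr, map_zero, map_zero])
    · exact fun b c => huniq _ _ (fun s => by simp only [hp, map_add]) (by simp only [hr, map_add])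
    · exact fun c => huniq _ _ (fun s => by rw [hp, GradedAlgHom.commutes, GradedAlgHom.commutes])
        (by rw [hr, GradedAlgHom.commutes, GradedAlgHom.commutes])
    · intro n b hb
      obtain ⟨x, hx, hxp, hxr⟩ := hex n b hb
      have hxb : x = h b := huniq _ _ (fun s => by rw [hp, hxp]) (by rw [hr, hxr])
      change h b ∈ 𝒳 n
      rw [← hxb]
      exact hx
  refine ⟨H, ⟨fun s => GradedAlgHom.ext fun b => ?_, GradedAlgHom.ext fun b => ?_⟩, ?_⟩
  · rw [GradedAlgHom.comp_apply, hH, hp]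
  · rw [GradedAlgHom.comp_apply, hH, hr]
  · rintro h' ⟨hp', hr'⟩
    refine GradedAlgHom.ext fun b => huniq _ _ (fun s => ?_) ?_
    · rw [hH, hp, ← hp' s, GradedAlgHom.comp_apply]
    · rw [hH, hr, ← hr', GradedAlgHom.comp_apply]

end GradedLimit

/-! ### Splitting the multi-Koszul complex by tensor degree. -/

section Resolutions

variable {k : Type u} [Field k] {V : Type u} [AddCommGroup V] [Module k V]

lemma projT_mem_of_le {R : Submodule k (TensorAlgebra k V)} {s : ℕ} (hR : R ≤ tensorPow k V s)
    {x : TensorAlgebra k V} (hx : x ∈ R) (n : ℕ) : projT n x ∈ R := by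
  by_cases h : s = n
  · subst h
    rwa [projT_of_mem (hR hx)]
  · rw [projT_of_mem_ne (hR hx) h]
    exact zero_mem _

lemma isGradedQuotient_mk {R : Submodule k (TensorAlgebra k V)}
    (hR : ∀ x ∈ R, ∀ n, projT n x ∈ R) : IsGradedQuotient (QuotAlg.mk R) where
  surjective := Ideal.Quotient.mk_surjective
  map_projT _ n hx := Ideal.Quotient.eq_zero_iff_mem.2
    (projT_mem_relIdeal hR (Ideal.Quotient.eq_zero_iff_mem.1 hx) n)

namespace Presentation

variable (P : Presentation k V)

lemma projT_mem_rel {x : TensorAlgebra k V} (hx : x ∈ P.rel) (n : ℕ) : projT n x ∈ P.rel := by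
  have h : P.rel ≤ P.rel.comap (projT n) := iSup₂_le fun s hs y hy =>
    P.R_le_rel hs (projT_mem_of_le (P.R_le s hs) hy n)
  exact h hx

lemma koszulSpace_le_J {s : ℕ} (hs : s ∈ P.S) : ∀ n, koszulSpace (P.R s) s n ≤ P.J n
  | 0 => le_rfl
  | 1 => le_rfl
  | _ + 2 => le_iSup₂_of_le s hs le_rfl

lemma projDeg_eq_self {n : ℕ} {J : Submodule k (TensorAlgebra k V)} (hJ : J ≤ tensorPow k V n)
    {x} (hx : x ∈ J.baseChange P.Alg) : P.projDeg n x = x := by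
  have h : J.baseChange P.Alg ≤ LinearMap.eqLocus (P.projDeg n) LinearMap.id :=
    baseChange_le fun y hy => by
      change (1 : P.Alg) ⊗ₜ[k] projT n y = 1 ⊗ₜ y
      rw [projT_of_mem (hJ hy)]
  exact h hx

lemma projDeg_eq_zero {m n : ℕ} (hmn : m ≠ n) {J : Submodule k (TensorAlgebra k V)}
    (hJ : J ≤ tensorPow k V m) {x} (hx : x ∈ J.baseChange P.Alg) : P.projDeg n x = 0 := by
  have h : J.baseChange P.Alg ≤ LinearMap.ker (P.projDeg n) :=
    baseChange_le fun y hy => by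
      change (1 : P.Alg) ⊗ₜ[k] projT n y = 0
      rw [projT_of_mem_ne (hJ hy) hmn, TensorProduct.tmul_zero]
  exact h hx

lemma koszulSpace_le_tensorPow {s : ℕ} (hs : s ∈ P.S) (n : ℕ) :
    koszulSpace (P.R s) s n ≤ tensorPow k V (deg s n) :=
  koszulSpace_le (P.two_le s hs) (P.R_le s hs) n

lemma projDeg_mem {s : ℕ} (hs : s ∈ P.S) (n : ℕ) {x} (hx : x ∈ P.K (n + 2)) :
    P.projDeg (deg s (n + 2)) x ∈ (koszulSpace (P.R s) s (n + 2)).baseChange P.Alg := by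
  have hJ : P.J (n + 2) ≤ (koszulSpace (P.R s) s (n + 2)).comap (projT (deg s (n + 2))) := by
    refine iSup₂_le fun t ht y hy => ?_
    rw [JS_eq] at hy
    rw [Submodule.mem_comap]
    by_cases h : t = s
    · subst h
      rwa [projT_of_mem (P.koszulSpace_le_tensorPow ht _ hy)]
    · rw [projT_of_mem_ne (P.koszulSpace_le_tensorPow ht _ hy)
        fun h' => h (deg_injective n h')]
      exact zero_mem _
  have h : P.K (n + 2) ≤ ((koszulSpace (P.R s) s (n + 2)).baseChange P.Alg).comap
      (P.projDeg (deg s (n + 2))) :=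
    baseChange_le fun y hy => Submodule.tmul_mem_baseChange_of_mem _ (hJ hy)
  exact h hx

lemma δ_add_two_apply (n : ℕ) (x : P.Alg ⊗[k] TensorAlgebra k V) : P.δ (n + 2) x =
    ∑ s ∈ P.S, (shift (QuotAlg.mk P.rel) ^ step s (n + 1)) (P.projDeg (deg s (n + 2)) x) := by
  rw [δ, LinearMap.sum_apply]
  refine Finset.sum_congr rfl fun s _ => ?_
  have h : (if Even n then s - 1 else 1) = step s (n + 1) :=
    if_congr (by rw [add_assoc, Nat.even_add]; simp) rfl rfl
  rw [h]
  rfl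

lemma δ_apply {s : ℕ} (hs : s ∈ P.S) (n : ℕ) {x}
    (hx : x ∈ (koszulSpace (P.R s) s (n + 1)).baseChange P.Alg) :
    P.δ (n + 1) x = (shift (QuotAlg.mk P.rel) ^ step s n) x := by
  match n with
  | 0 =>
    have h : step s 0 = 1 := if_neg (by decide)
    rw [h, pow_one]
    rfl
  | n + 1 =>
    rw [δ_add_two_apply, Finset.sum_eq_single_of_mem s hs,
      P.projDeg_eq_self (P.koszulSpace_le_tensorPow hs _) hx]
    intro t _ hts
    rw [P.projDeg_eq_zero (fun h => hts (deg_injective n h).symm)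
      (P.koszulSpace_le_tensorPow hs _) hx, map_zero]

variable [FiniteDimensional k V] {P}

/-- From degree `2` on the differential preserves the decomposition of `J` over `s`. So the
`s`-component of a preimage under `δ` is still a preimage. -/
lemma IsMultiKoszul.exact_koszulSpace (hA : P.IsMultiKoszul) {s : ℕ} (hs : s ∈ P.S) (n : ℕ)
    {x} (hx : x ∈ (koszulSpace (P.R s) s (n + 2)).baseChange P.Alg)
    (h : (shift (QuotAlg.mk P.rel) ^ step s (n + 1)) x = 0) :
    ∃ y ∈ (koszulSpace (P.R s) s (n + 3)).baseChange P.Alg,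
      (shift (QuotAlg.mk P.rel) ^ step s (n + 2)) y = x := by
  obtain ⟨y, hy, hyx⟩ := (hA.exact_succ (n + 1) x
    (Submodule.baseChange_mono _ (P.koszulSpace_le_J hs _) hx)).1 (by rw [P.δ_apply hs _ hx, h])
  have hmem : ∀ t ∈ P.S, (shift (QuotAlg.mk P.rel) ^ step t (n + 2))
      (P.projDeg (deg t (n + 3)) y) ∈ (koszulSpace (P.R t) t (n + 2)).baseChange P.Alg :=
    fun t ht => shift_pow_mem _ (P.two_le t ht) (P.R_le t ht) (n + 2) (P.projDeg_mem ht (n + 1) hy)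
  refine ⟨_, P.projDeg_mem hs (n + 1) hy, ?_⟩
  rw [← P.projDeg_eq_self (P.koszulSpace_le_tensorPow hs (n + 2)) hx, ← hyx, δ_add_two_apply,
    map_sum, Finset.sum_eq_single_of_mem s hs, P.projDeg_eq_self
      (P.koszulSpace_le_tensorPow hs (n + 2)) (hmem s hs)]
  intro t ht hts
  exact P.projDeg_eq_zero (fun h => hts (deg_injective n h))
    (P.koszulSpace_le_tensorPow ht (n + 2)) (hmem t ht)

end Presentation
end Resolutions

/-! ### Maps of Yoneda algebras and inclusions of generators. -/

section YonedaMaps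

variable {k : Type u} [Field k] {V : Type u} [AddCommGroup V] [Module k V]
variable {A B : Type u} [Ring A] [Algebra k A] [Ring B] [Algebra k B]

lemma positivePart_mono (ε : A →ₐ[k] k) {J J' : Submodule k (TensorAlgebra k V)} (h : J ≤ J') :
    positivePart ε J ≤ positivePart ε J' :=
  Submodule.span_mono fun _ ⟨a, ha, x, hx, hy⟩ => ⟨a, ha, x, h hx, hy⟩

lemma yonedaAlgebraMap_lof {εA : A →ₐ[k] k} {εB : B →ₐ[k] k} (φ : A →ₐ[k] B)
    (h : εB.comp φ = εA) {n : ℕ} (α : SelfExt (trivialModule εB) n) :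
    yonedaAlgebraMap φ h (DirectSum.lof k ℕ (SelfExt (trivialModule εB)) n α) =
      DirectSum.lof k ℕ (SelfExt (trivialModule εA)) n
        (SelfExt.map (k := k) (ModuleCat.restrictScalars φ.toRingHom) (trivialModuleIso φ h) n α) :=
  ExtAlgebra.map_lof (k := k) (C := ModuleCat.{u} B) (D := ModuleCat.{u} A) _ _ n α

namespace FreeResolution

variable {εA : A →ₐ[k] k} {εB : B →ₐ[k] k}

lemma coeff_eq_of_eq_bot (F : FreeResolution V εA) {n : ℕ} (hJ : F.J n = ⊥)
    (α β : SelfExt (trivialModule εA) n) : α = β := by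
  refine F.coeff_injective fun ⟨x, hx⟩ => ?_
  obtain ⟨lam, hlam⟩ := F.exists_eq_coeff α
  obtain ⟨mu, hmu⟩ := F.exists_eq_coeff β
  rw [hlam, hmu]
  have hx0 : x = 0 := by rwa [hJ, Submodule.mem_bot] at hx
  simp [hx0]

lemma map_bijective {F : FreeResolution V εA} {G : FreeResolution V εB} {φ : A →ₐ[k] B}
    (hφ : εB.comp φ = εA) (hJ : ∀ n, F.J n ≤ G.J n)
    (hd : ∀ n, ∀ x ∈ F.J (n + 1), semiMap φ (F.d n (1 ⊗ₜ x)) = G.d n (1 ⊗ₜ x)) {n : ℕ}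
    (hn : G.J n ≤ F.J n) :
    Function.Bijective (SelfExt.map (k := k) (ModuleCat.restrictScalars φ.toRingHom)
      (trivialModuleIso φ hφ) n) := by
  constructor
  · intro α β h
    refine G.coeff_injective fun x => ?_
    rw [← coeff_map hφ hJ hd α ⟨x, hn x.2⟩, h, coeff_map hφ hJ hd]
  · intro β
    obtain ⟨lam, hlam⟩ := F.exists_eq_coeff β
    obtain ⟨α, hα⟩ := G.exists_coeff_eq (n := n) lam
    refine ⟨α, F.coeff_injective fun x => ?_⟩
    rw [coeff_map hφ hJ hd, hα, hlam]

end FreeResolution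

end YonedaMaps

/-! ### The resolutions over `A`, `A^s` and `T(V)`, and their comparison maps. -/

namespace Presentation

variable {k : Type u} [Field k] {V : Type u} [AddCommGroup V] [Module k V]
  {P : Presentation k V} [FiniteDimensional k V]

lemma δ_mem_positivePart (n : ℕ) {x : TensorAlgebra k V} (hx : x ∈ P.J (n + 1)) :
    P.δ (n + 1) (1 ⊗ₜ x) ∈ positivePart P.aug (P.J n) := by
  match n with
  | 0 =>
    have h := shift_pow_mem_positivePart (p := QuotAlg.mk P.rel) (ε := P.aug)
      (J := tensorPow k V 0) (c := 1) (Ideal.Quotient.liftₐ_comp _ _ _) one_ne_zero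
      (x := x) (by rw [tensorPow, tensorPow, pow_zero, mul_one]; exact hx)
    rwa [pow_one] at h
  | n + 1 =>
    have h : P.J (n + 2) ≤ ((positivePart P.aug (P.J (n + 1))).restrictScalars k).comap
        ((P.δ (n + 2)).restrictScalars k ∘ₗ TensorProduct.mk k _ _ 1) := by
      refine iSup₂_le fun s hs y hy => ?_
      rw [JS_eq] at hy
      change P.δ (n + 2) (1 ⊗ₜ y) ∈ positivePart P.aug (P.J (n + 1))
      rw [P.δ_apply hs (n + 1) (Submodule.tmul_mem_baseChange_of_mem 1 hy)]
      exact positivePart_mono _ (P.koszulSpace_le_J hs (n + 1)) (shift_pow_mem_positivePart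
        (Ideal.Quotient.liftₐ_comp _ _ _) (step_pos (P.two_le s hs) _).ne'
        (koszulSpace_succ_le (P.two_le s hs) (P.R_le s hs) (n + 1) hy))
    exact h hx

/-- The multi-Koszul resolution. -/
noncomputable def resolution (hA : P.IsMultiKoszul) : FreeResolution V P.aug where
  J := P.J
  d n := P.δ (n + 1)
  one_mem := by
    rw [J, tensorPow, pow_zero]
    exact Submodule.one_le.1 le_rfl
  d_mem n x hx := δ_mem_positivePart n hx
  exact_zero x hx h := (hA.exact_zero x hx).1 h
  d_d n x hx := (hA.exact_succ n _ (positivePart_le _ _ (δ_mem_positivePart (n + 1) hx))).2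
    ⟨_, Submodule.tmul_mem_baseChange_of_mem 1 hx, rfl⟩
  exact_succ n x hx h := (hA.exact_succ n x hx).1 h

lemma exact_koszulSpace_algS (hA : P.IsMultiKoszul) (s : P.S) (n : ℕ)
    (x : P.AlgS s ⊗[k] TensorAlgebra k V)
    (hx : x ∈ (koszulSpace (P.R s) s (n + 2)).baseChange (P.AlgS s))
    (h : (shift (QuotAlg.mk (P.R s)) ^ step s (n + 1)) x = 0) :
    ∃ y ∈ (koszulSpace (P.R s) s (n + 3)).baseChange (P.AlgS s),
      (shift (QuotAlg.mk (P.R s)) ^ step s (n + 2)) y = x := by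
  have : Nontrivial P.Alg := P.aug.toRingHom.domain_nontrivial
  have hπ : (QuotAlg.factor (P.R_le_rel s.2)).comp (QuotAlg.mk (P.R s)) = QuotAlg.mk P.rel := rfl
  have hp : IsGradedQuotient (QuotAlg.mk (P.R s)) :=
    isGradedQuotient_mk fun y hy => projT_mem_of_le (P.R_le s s.2) hy
  have hπ' : IsGradedQuotient
      ((QuotAlg.factor (P.R_le_rel s.2)).comp (QuotAlg.mk (P.R s))) := by
    rw [hπ]
    exact isGradedQuotient_mk fun y hy => P.projT_mem_rel hy
  refine exists_shift_pow_eq_of_quotient (A := P.Alg) (B := P.AlgS s) (p := QuotAlg.mk (P.R s))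
    (π := QuotAlg.factor (P.R_le_rel s.2)) hp hπ' (P.two_le s s.2) (P.R_le s s.2)
    (fun _ => Ideal.Quotient.eq_zero_iff_mem) (fun n x hx h => ?_) n hx h
  rw [hπ] at h ⊢
  exact hA.exact_koszulSpace s.2 n hx h

/-- The Koszul resolution over `A^s`. -/
noncomputable def resolutionS (hA : P.IsMultiKoszul) (s : P.S) : FreeResolution V (P.augS s) :=
  koszulResolution (ε := P.augS s) (p := QuotAlg.mk (P.R s)) (Ideal.Quotient.liftₐ_comp _ _ _)
    (P.two_le s s.2) (P.R_le s s.2) Ideal.Quotient.mk_surjective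
    (fun _ => Ideal.Quotient.eq_zero_iff_mem) (exact_koszulSpace_algS hA s)

omit [FiniteDimensional k V] in
lemma koszulSpace_bot (n : ℕ) : koszulSpace (⊥ : Submodule k (TensorAlgebra k V)) 2 (n + 2) = ⊥ :=
  le_bot_iff.1 ((koszulSpace_add_two_le_mul n).trans (by rw [Submodule.bot_mul]))

variable (k V) in
/-- The resolution of the trivial module over the tensor algebra. -/
noncomputable def tensorResolution : FreeResolution V (tensorAug : TensorAlgebra k V →ₐ[k] k) :=
  -- Without relations the choice of `s ≥ 2` is immaterial: only the terms `k` and `V` survive.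
  koszulResolution (p := AlgHom.id k (TensorAlgebra k V)) (R := ⊥) (s := 2) (AlgHom.comp_id _)
    le_rfl bot_le Function.surjective_id
    (fun x => ⟨fun h => by rw [show x = 0 from h]; exact zero_mem _,
      eq_zero_of_mem_relIdeal (AlgHom.id k _) (fun y hy => by
        rw [(Submodule.mem_bot k).1 hy, map_zero]) x⟩)
    (fun n x hx _ => by
      rw [koszulSpace_bot, Submodule.baseChange_bot, Submodule.mem_bot] at hx
      exact ⟨0, zero_mem _, by rw [hx, map_zero]⟩)

lemma tensorResolution_J (n : ℕ) : (tensorResolution k V).J (n + 2) = ⊥ := koszulSpace_bot n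

variable (hA : P.IsMultiKoszul) (s : P.S)

lemma tensorResolution_J_le (J : ℕ → Submodule k (TensorAlgebra k V)) (h0 : J 0 = tensorPow k V 0)
    (h1 : J 1 = tensorPow k V 1) : ∀ n, (tensorResolution k V).J n ≤ J n
  | 0 => h0.ge
  | 1 => h1.ge
  | n + 2 => by rw [tensorResolution_J]; exact bot_le

lemma le_tensorResolution_J (J : ℕ → Submodule k (TensorAlgebra k V)) (h0 : J 0 = tensorPow k V 0)
    (h1 : J 1 = tensorPow k V 1) : ∀ n < 2, J n ≤ (tensorResolution k V).J n
  | 0, _ => h0.le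
  | 1, _ => h1.le
  | n + 2, h => by lia

lemma semiMap_tensorResolution_d {A : Type u} [Ring A] [Algebra k A] (p : TensorAlgebra k V →ₐ[k] A)
    (d : ℕ → (A ⊗[k] TensorAlgebra k V →ₗ[A] A ⊗[k] TensorAlgebra k V)) (h0 : d 0 = shift p) :
    ∀ n, ∀ x ∈ (tensorResolution k V).J (n + 1),
      semiMap p ((tensorResolution k V).d n (1 ⊗ₜ x)) = d n (1 ⊗ₜ x)
  | 0, x, _ => by
    rw [h0]
    refine (map_shift_pow (p := AlgHom.id k (TensorAlgebra k V)) (π := p) (step 2 0) _).trans ?_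
    have h : step 2 0 = 1 := if_neg (by decide)
    rw [h, pow_one, AlgHom.comp_id, LinearMap.rTensor_tmul, AlgHom.toLinearMap_apply, map_one]
  | n + 1, x, hx => by
    rw [tensorResolution_J, Submodule.mem_bot] at hx
    rw [hx, TensorProduct.tmul_zero, map_zero, map_zero, TensorProduct.tmul_zero, map_zero]

lemma semiMap_resolutionS_d (n : ℕ) (x : TensorAlgebra k V)
    (hx : x ∈ (resolutionS hA s).J (n + 1)) :
    semiMap (QuotAlg.factor (P.R_le_rel s.2)) ((resolutionS hA s).d n (1 ⊗ₜ x)) =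
      (resolution hA).d n (1 ⊗ₜ x) := by
  refine (map_shift_pow (p := QuotAlg.mk (P.R s)) (π := QuotAlg.factor (P.R_le_rel s.2))
    (step s n) _).trans ?_
  refine Eq.trans ?_ (P.δ_apply s.2 n (Submodule.tmul_mem_baseChange_of_mem 1 hx)).symm
  rw [LinearMap.rTensor_tmul, AlgHom.toLinearMap_apply, map_one]
  rfl

end Presentation

/-! ### Homogeneous elements of the Yoneda algebra. -/

section YonedaMaps

variable {k : Type u} [Field k] {V : Type u} [AddCommGroup V] [Module k V]
variable {A B : Type u} [Ring A] [Algebra k A] [Ring B] [Algebra k B]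
variable {εA : A →ₐ[k] k} {εB : B →ₐ[k] k}

variable (εA) in
/-- The inclusion of `Ext^n(k, k)` into the Yoneda algebra. -/
noncomputable abbrev yonedaOf (n : ℕ) : SelfExt (trivialModule εA) n →ₗ[k] YonedaAlgebra εA :=
  DirectSum.lof k ℕ (SelfExt (trivialModule εA)) n

lemma yonedaOf_injective (n : ℕ) : Function.Injective (yonedaOf εA n) :=
  DirectSum.of_injective n

lemma exists_map_yonedaOf (f : yonedaGrading εB →ₐᵍ[k] yonedaGrading εA) {n : ℕ}
    {x} (hx : x ∈ yonedaGrading εB n) : ∃ β, f x = yonedaOf εA n β :=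
  let ⟨β, hβ⟩ := f.map_mem hx
  ⟨β, hβ.symm⟩

lemma exists_yonedaOf_add_eq {x : YonedaAlgebra εA}
    (hx : x ∈ yonedaGrading εA 0 ⊔ yonedaGrading εA 1) :
    ∃ a b, yonedaOf εA 0 a +
      yonedaOf εA 1 b = x := by
  obtain ⟨_, ⟨a, rfl⟩, _, ⟨b, rfl⟩, h⟩ := Submodule.mem_sup.1 hx
  exact ⟨a, b, h⟩

lemma yonedaOf_add_inj {a c : SelfExt (trivialModule εA) 0} {b d : SelfExt (trivialModule εA) 1}
    (h : yonedaOf εA 0 a + yonedaOf εA 1 b = yonedaOf εA 0 c + yonedaOf εA 1 d) :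
    a = c ∧ b = d := by
  have key : ∀ (a : SelfExt (trivialModule εA) 0) (b : SelfExt (trivialModule εA) 1),
      (yonedaOf εA 0 a + yonedaOf εA 1 b) 0 = a ∧ (yonedaOf εA 0 a + yonedaOf εA 1 b) 1 = b := by
    intro a b
    constructor
    · refine (DirectSum.add_apply _ _ 0).trans ?_
      rw [DirectSum.lof_eq_of, DirectSum.lof_eq_of, DirectSum.of_eq_same,
        DirectSum.of_eq_of_ne _ _ _ (by decide), add_zero]
    · refine (DirectSum.add_apply _ _ 1).trans ?_
      rw [DirectSum.lof_eq_of, DirectSum.lof_eq_of, DirectSum.of_eq_same,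
        DirectSum.of_eq_of_ne _ _ _ (by decide), zero_add]
  have h' := key a b
  rw [h] at h'
  exact ⟨h'.1.symm.trans (key c d).1, h'.2.symm.trans (key c d).2⟩

lemma FreeResolution.exists_yonedaAlgebraMap_yonedaOf {F : FreeResolution V εA}
    {G : FreeResolution V εB} {φ : A →ₐ[k] B} (hφ : εB.comp φ = εA) (hJ : ∀ n, F.J n ≤ G.J n)
    (hd : ∀ n, ∀ x ∈ F.J (n + 1), semiMap φ (F.d n (1 ⊗ₜ x)) = G.d n (1 ⊗ₜ x)) {n : ℕ}
    {α : SelfExt (trivialModule εB) n} {lam : TensorAlgebra k V →ₗ[k] k}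
    (hα : ∀ x, G.coeff α x = lam x) :
    ∃ β, yonedaAlgebraMap φ hφ (yonedaOf εB n α) =
      yonedaOf εA n β ∧ ∀ x, F.coeff β x = lam x :=
  ⟨_, yonedaAlgebraMap_lof φ hφ α, fun x => by rw [coeff_map hφ hJ hd, hα]⟩

lemma FreeResolution.eq_of_coeff_eq (F : FreeResolution V εA) {n : ℕ}
    {α β : SelfExt (trivialModule εA) n} {lam mu : TensorAlgebra k V →ₗ[k] k}
    (hα : ∀ x, F.coeff α x = lam x) (hβ : ∀ x, F.coeff β x = mu x)
    (h : ∀ x ∈ F.J n, lam x = mu x) : α = β :=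
  F.coeff_injective fun x => by rw [hα, hβ, h x x.2]

end YonedaMaps

/-! ### The maps `p_s`, `q_s` and `r` as restrictions of functionals. -/

namespace Presentation

variable {k : Type u} [Field k] {V : Type u} [AddCommGroup V] [Module k V]
  {P : Presentation k V} [FiniteDimensional k V] (hA : P.IsMultiKoszul) {n : ℕ}

lemma exists_p_yonedaOf (s : P.S) {α : SelfExt (trivialModule P.aug) n}
    {lam : TensorAlgebra k V →ₗ[k] k} (hα : ∀ x, (resolution hA).coeff α x = lam x) :
    ∃ β, P.p s (yonedaOf P.aug n α) =
      yonedaOf (P.augS s) n β ∧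
        ∀ x, (resolutionS hA s).coeff β x = lam x :=
  FreeResolution.exists_yonedaAlgebraMap_yonedaOf _ (P.koszulSpace_le_J s.2)
    (semiMap_resolutionS_d hA s) hα

lemma semiMap_tensorResolution_d_algS (s : P.S) (m : ℕ) (x : TensorAlgebra k V)
    (hx : x ∈ (tensorResolution k V).J (m + 1)) :
    semiMap (QuotAlg.mk (P.R s)) ((tensorResolution k V).d m (1 ⊗ₜ x)) =
      (resolutionS hA s).d m (1 ⊗ₜ x) :=
  semiMap_tensorResolution_d _ (resolutionS hA s).d (pow_one _) m x hx

lemma exists_q_yonedaOf (s : P.S) {α : SelfExt (trivialModule (P.augS s)) n}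
    {lam : TensorAlgebra k V →ₗ[k] k} (hα : ∀ x, (resolutionS hA s).coeff α x = lam x) :
    ∃ β, P.q s (yonedaOf (P.augS s) n α) =
      yonedaOf (tensorAug : TensorAlgebra k V →ₐ[k] k) n β ∧
        ∀ x, (tensorResolution k V).coeff β x = lam x :=
  FreeResolution.exists_yonedaAlgebraMap_yonedaOf (G := resolutionS hA s) _
    (tensorResolution_J_le _ rfl rfl) (semiMap_tensorResolution_d_algS hA s) hα

lemma exists_r_yonedaOf {α : SelfExt (trivialModule P.aug) n}
    {lam : TensorAlgebra k V →ₗ[k] k} (hα : ∀ x, (resolution hA).coeff α x = lam x) :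
    ∃ β, P.r (yonedaOf P.aug n α) =
      yonedaOf (tensorAug : TensorAlgebra k V →ₐ[k] k) n β ∧
        ∀ x, (tensorResolution k V).coeff β x = lam x :=
  FreeResolution.exists_yonedaAlgebraMap_yonedaOf (G := resolution hA) _
    (tensorResolution_J_le _ rfl rfl)
    (semiMap_tensorResolution_d _ (resolution hA).d rfl) hα

lemma eq_tensorExt (hn : 2 ≤ n)
    (α β : SelfExt (trivialModule (tensorAug : TensorAlgebra k V →ₐ[k] k)) n) : α = β := by
  obtain ⟨m, rfl⟩ := Nat.exists_eq_add_of_le' hn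
  exact (tensorResolution k V).coeff_eq_of_eq_bot (tensorResolution_J m) α β

include hA in
lemma q_comp_p (s : P.S) : (P.q s).comp (P.p s) = P.r := by
  refine GradedAlgHom.ext fun x => ?_
  rw [GradedAlgHom.comp_apply]
  induction x using DirectSum.induction_on with
  | zero => simp only [map_zero]
  | add x y hx hy => simp only [map_add, hx, hy]
  | of n α =>
    obtain ⟨lam, hlam⟩ := (resolution hA).exists_eq_coeff α
    obtain ⟨β, hβ, hβ'⟩ := exists_p_yonedaOf hA s hlam
    obtain ⟨γ, hγ, hγ'⟩ := exists_q_yonedaOf hA s hβ'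
    obtain ⟨δ, hδ, hδ'⟩ := exists_r_yonedaOf hA hlam
    rw [DirectSum.lof_eq_of] at hβ hδ
    rw [hβ, hγ, hδ, (tensorResolution k V).eq_of_coeff_eq hγ' hδ' fun _ _ => rfl]

/-- Functionals on `J n` are detected on the `J_n^s` for `n ≥ 2`, and on the generators over `T(V)`
for `n < 2`. The second term is what covers an empty `S`. -/
lemma J_le_sup : ∀ n, P.J n ≤ (⨆ s ∈ P.S, koszulSpace (P.R s) s n) ⊔ (tensorResolution k V).J n
  | 0 => le_sup_right
  | 1 => le_sup_right
  | _ + 2 => le_sup_of_le_left (iSup₂_mono fun s _ => (P.JS_eq s _).le)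

include hA in
lemma eq_of_p_eq_of_r_eq {α β : SelfExt (trivialModule P.aug) n}
    (hp : ∀ s, P.p s (yonedaOf P.aug n α) = P.p s (yonedaOf P.aug n β))
    (hr : P.r (yonedaOf P.aug n α) = P.r (yonedaOf P.aug n β)) : α = β := by
  obtain ⟨lam, hlam⟩ := (resolution hA).exists_eq_coeff α
  obtain ⟨mu, hmu⟩ := (resolution hA).exists_eq_coeff β
  suffices h : P.J n ≤ LinearMap.eqLocus lam mu from
    (resolution hA).eq_of_coeff_eq hlam hmu fun _ hx => h hx
  refine (J_le_sup n).trans (sup_le (iSup₂_le fun s hs x hx => ?_) fun x hx => ?_)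
  · obtain ⟨γ, hγ, hγ'⟩ := exists_p_yonedaOf hA ⟨s, hs⟩ hlam
    obtain ⟨δ, hδ, hδ'⟩ := exists_p_yonedaOf hA ⟨s, hs⟩ hmu
    have h : γ = δ := yonedaOf_injective _ (by rw [← hγ, ← hδ, hp])
    exact (hγ' ⟨x, hx⟩).symm.trans (by rw [h, hδ'])
  · obtain ⟨γ, hγ, hγ'⟩ := exists_r_yonedaOf hA hlam
    obtain ⟨δ, hδ, hδ'⟩ := exists_r_yonedaOf hA hmu
    have h : γ = δ := yonedaOf_injective _ (by rw [← hγ, ← hδ, hr])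
    exact (hγ' ⟨x, hx⟩).symm.trans (by rw [h, hδ'])

include hA in
lemma exists_p_eq (hn : 2 ≤ n) (β : ∀ s : P.S, SelfExt (trivialModule (P.augS s)) n) :
    ∃ α : SelfExt (trivialModule P.aug) n, ∀ s, P.p s (yonedaOf P.aug n α) =
      yonedaOf (P.augS s) n (β s) := by
  choose lam hlam using fun s => (resolutionS hA s).exists_eq_coeff (β s)
  obtain ⟨α, hα⟩ := (resolution hA).exists_coeff_eq (n := n)
    -- Projecting to tensor degree `n_s(n)` isolates `J_n^s`, since these degrees are distinct for
    -- `n ≥ 2`.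
    (∑ s : P.S, lam s ∘ₗ projT (deg s n))
  refine ⟨α, fun s => ?_⟩
  obtain ⟨γ, hγ, hγ'⟩ := exists_p_yonedaOf hA s hα
  rw [hγ, (resolutionS hA s).eq_of_coeff_eq hγ' (hlam s)]
  intro x hx
  have hx' : x ∈ tensorPow k V (deg s n) := P.koszulSpace_le_tensorPow s.2 n hx
  rw [LinearMap.sum_apply, Finset.sum_eq_single_of_mem s (Finset.mem_univ s),
    LinearMap.comp_apply, projT_of_mem hx']
  intro t _ hts
  obtain ⟨m, rfl⟩ := Nat.exists_eq_add_of_le' hn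
  rw [LinearMap.comp_apply,
    projT_of_mem_ne hx' fun h => hts (Subtype.ext (deg_injective m h).symm), map_zero]

include hA in
lemma exists_r_eq (hn : n < 2)
    (γ : SelfExt (trivialModule (tensorAug : TensorAlgebra k V →ₐ[k] k)) n) :
    ∃ α : SelfExt (trivialModule P.aug) n, P.r (yonedaOf P.aug n α) =
      yonedaOf (tensorAug : TensorAlgebra k V →ₐ[k] k) n γ := by
  obtain ⟨α, hα⟩ := (FreeResolution.map_bijective (φ := QuotAlg.mk P.rel) (G := resolution hA)
    (Ideal.Quotient.liftₐ_comp _ _ _) (tensorResolution_J_le _ rfl rfl)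
    (semiMap_tensorResolution_d _ (resolution hA).d rfl)
    (le_tensorResolution_J (resolution hA).J rfl rfl n hn)).2 γ
  exact ⟨α, (yonedaAlgebraMap_lof _ _ α).trans (congrArg _ hα)⟩

include hA in
lemma q_yonedaOf_injective (s : P.S) (hn : n < 2) :
    Function.Injective fun α : SelfExt (trivialModule (P.augS s)) n =>
      P.q s (yonedaOf (P.augS s) n α) := by
  intro α β h
  refine (FreeResolution.map_bijective (φ := QuotAlg.mk (P.R s)) (G := resolutionS hA s)
    (Ideal.Quotient.liftₐ_comp _ _ _) (tensorResolution_J_le _ rfl rfl)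
    (semiMap_tensorResolution_d_algS hA s)
    (le_tensorResolution_J (resolutionS hA s).J rfl rfl n hn)).1
    (yonedaOf_injective _ ?_)
  exact (yonedaAlgebraMap_lof _ _ α).symm.trans (h.trans (yonedaAlgebraMap_lof _ _ β))

include hA in
lemma exists_p_eq_r_eq (y : ∀ s : P.S, YonedaAlgebra (P.augS s))
    (z : YonedaAlgebra (tensorAug : TensorAlgebra k V →ₐ[k] k))
    (hy : ∀ s, y s ∈ yonedaGrading (P.augS s) n)
    (hz : z ∈ yonedaGrading (tensorAug : TensorAlgebra k V →ₐ[k] k) n)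
    (hq : ∀ s, P.q s (y s) = z) :
    ∃ x ∈ yonedaGrading P.aug n, (∀ s, P.p s x = y s) ∧ P.r x = z := by
  choose β hβ using hy
  obtain ⟨γ, rfl⟩ := hz
  obtain hn | hn := lt_or_ge n 2
  · obtain ⟨α, hα⟩ := exists_r_eq hA hn γ
    refine ⟨_, ⟨α, rfl⟩, fun s => ?_, hα⟩
    obtain ⟨δ, hδ⟩ := exists_map_yonedaOf (P.p s) (x := yonedaOf P.aug n α) ⟨α, rfl⟩
    -- In degrees below `2` the map `q_s` is injective, so `p_s x = y s` may be tested after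
    -- applying `q_s`.
    have h : P.q s (yonedaOf (P.augS s) n δ) = P.q s (yonedaOf (P.augS s) n (β s)) := by
      rw [← hδ, hβ, hq, ← GradedAlgHom.comp_apply, q_comp_p hA s, hα]
    rw [hδ, q_yonedaOf_injective hA s hn h, hβ]
  · obtain ⟨α, hα⟩ := exists_p_eq hA hn β
    refine ⟨_, ⟨α, rfl⟩, fun s => (hα s).trans (hβ s), ?_⟩
    obtain ⟨δ, hδ⟩ := exists_map_yonedaOf P.r (x := yonedaOf P.aug n α) ⟨α, rfl⟩
    rw [hδ, eq_tensorExt hn δ γ]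

lemma q_eq_zero (s : P.S) (hn : 2 ≤ n) {x} (hx : x ∈ yonedaGrading (P.augS s) n) :
    P.q s x = 0 := by
  obtain ⟨γ, hγ⟩ := exists_map_yonedaOf (P.q s) hx
  rw [hγ, eq_tensorExt hn γ 0, map_zero]

include hA in
lemma q_injOn (s : P.S) : Set.InjOn (P.q s)
    (yonedaGrading (P.augS s) 0 ⊔ yonedaGrading (P.augS s) 1 :
      Submodule k (YonedaAlgebra (P.augS s))) := by
  intro x hx y hy hxy
  obtain ⟨a, b, rfl⟩ := exists_yonedaOf_add_eq hx
  obtain ⟨c, d, rfl⟩ := exists_yonedaOf_add_eq hy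
  obtain ⟨a', ha⟩ := exists_map_yonedaOf (P.q s) (n := 0) ⟨a, rfl⟩
  obtain ⟨b', hb⟩ := exists_map_yonedaOf (P.q s) (n := 1) ⟨b, rfl⟩
  obtain ⟨c', hc⟩ := exists_map_yonedaOf (P.q s) (n := 0) ⟨c, rfl⟩
  obtain ⟨d', hd⟩ := exists_map_yonedaOf (P.q s) (n := 1) ⟨d, rfl⟩
  rw [map_add, map_add, ha, hb, hc, hd] at hxy
  obtain ⟨h0, h1⟩ := yonedaOf_add_inj hxy
  rw [q_yonedaOf_injective hA s (by decide) (ha.trans ((congrArg _ h0).trans hc.symm)),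
    q_yonedaOf_injective hA s (by decide) (hb.trans ((congrArg _ h1).trans hd.symm))]

include hA in
lemma exists_q_eq (s : P.S) (z : YonedaAlgebra (tensorAug : TensorAlgebra k V →ₐ[k] k)) :
    ∃ x ∈ yonedaGrading (P.augS s) 0 ⊔ yonedaGrading (P.augS s) 1, P.q s x = z := by
  induction z using DirectSum.induction_on with
  | zero => exact ⟨0, zero_mem _, map_zero _⟩
  | add z w hz hw =>
    obtain ⟨x, hx, rfl⟩ := hz
    obtain ⟨y, hy, rfl⟩ := hw
    exact ⟨x + y, add_mem hx hy, map_add _ _ _⟩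
  | of n γ =>
    obtain hn | hn := lt_or_ge n 2
    · obtain ⟨α, hα⟩ := exists_r_eq hA hn γ
      -- Since `q_s ∘ p_s = r`, surjectivity of `r` in degrees below `2` passes to `q_s`.
      refine ⟨P.p s (yonedaOf P.aug n α), ?_, ?_⟩
      · have h := (P.p s).map_mem (i := n) ⟨α, rfl⟩
        match n with
        | 0 => exact Submodule.mem_sup_left h
        | 1 => exact Submodule.mem_sup_right h
      · rw [← GradedAlgHom.comp_apply, q_comp_p hA s, hα]
        rfl
    · exact ⟨0, zero_mem _, by rw [eq_tensorExt hn γ 0, map_zero, map_zero]⟩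

end Presentation
end MultiKoszul

theorem mainTheorem4 {k : Type u} [Field k] {V : Type u} [AddCommGroup V] [Module k V]
    [FiniteDimensional k V] (P : MultiKoszul.Presentation k V) (hA : P.IsMultiKoszul) :
    (∀ s : P.S, (P.q s).comp (P.p s) = P.r) ∧
    (∀ {B : Type w} [Ring B] [Algebra k B] (ℬ : ℕ → Submodule k B) [GradedAlgebra ℬ]
      (f : ∀ s : P.S, ℬ →ₐᵍ[k] MultiKoszul.yonedaGrading (P.augS s))
      (g : ℬ →ₐᵍ[k] MultiKoszul.yonedaGrading
        (MultiKoszul.tensorAug : TensorAlgebra k V →ₐ[k] k)),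
      (∀ s : P.S, (P.q s).comp (f s) = g) →
      ∃! h : ℬ →ₐᵍ[k] MultiKoszul.yonedaGrading P.aug,
        (∀ s : P.S, (P.p s).comp h = f s) ∧ P.r.comp h = g) ∧
    (∀ s : P.S,
      (∀ n, 2 ≤ n → ∀ x ∈ MultiKoszul.yonedaGrading (P.augS s) n, P.q s x = 0) ∧
      Set.BijOn (P.q s)
        (MultiKoszul.yonedaGrading (P.augS s) 0 ⊔ MultiKoszul.yonedaGrading (P.augS s) 1 :
          Submodule k (MultiKoszul.YonedaAlgebra (P.augS s)))
        Set.univ) := by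
  open MultiKoszul MultiKoszul.Presentation in
  refine ⟨q_comp_p hA, fun ℬ _ f g hfg => ?_, fun s =>
    ⟨fun n hn x hx => q_eq_zero s hn hx,
      fun _ _ => Set.mem_univ _, q_injOn hA s, fun z _ => exists_q_eq hA s z⟩⟩
  refine MultiKoszul.existsUnique_lift P.p P.q P.r ?_
    (fun n y z hy hz hq => MultiKoszul.Presentation.exists_p_eq_r_eq hA y z hy hz hq) ℬ f g hfg
  rintro n _ ⟨α, rfl⟩ hp hr
  rw [MultiKoszul.Presentation.eq_of_p_eq_of_r_eq hA (α := α) (β := 0)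
    (fun s => by rw [hp, map_zero, map_zero]) (by rw [hr, map_zero, map_zero]), map_zero]
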